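/- Let $(M,g)$ be a smooth four-dimensional spacetime ($g$ a smooth Lorentzian metric of signature $(-,+,+,+)$) that satisfies the Einstein vacuum equations $$R_{\mu\nu}-\tfrac12 R\,g_{\mu\nu}=0 ,$$ and let $\Sigma$ be a smooth three-dimensional spatial hypersurface immersed in $M$, with smooth unit normal $n$ ($g_{\mu\nu}n^\mu n^\nu=-1$). Let $\gamma_{ij}$ be the Riemannian metric induced on $\Sigma$, $D$ its Levi-Civita derivative, ${}^{3}R_{ij}$ its Ricci tensor, $\nabla$ the Levi-Civita derivative of $g$, $K_{ij}$ the extrinsic curvature, i.e. $K_{ij}=-\nabla_i n_j$ projected to $\Sigma$, and $K=\gamma^{ij}K_{ij}$. Curvature is normalised by $(\nabla_\mu\nabla_\nu-\nabla_\nu\nabla_\mu)v^\alpha=R^\alpha{}_{\beta\mu\nu}v^\beta$, $R_{\beta\nu}=R^\alpha{}_{\beta\alpha\nu}$ (and likewise for $D$). Let $$W_{\alpha\beta\mu\nu}=R_{\alpha\beta\mu\nu}-(g_{\alpha[\mu}R_{\nu]\beta}-g_{\beta[\mu}R_{\nu]\alpha})+\tfrac13R\,g_{\alpha[\mu}g_{\nu]\beta}$$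 be the Weyl tensor, where $A_{[\mu\nu]}=\frac12(A_{\mu\nu}-A_{\nu\mu})$, let $W^*{}_{\alpha\beta\mu\nu}=\frac12W_{\alpha\beta\lambda\delta}\,\varepsilon^{\lambda\delta}{}_{\mu\nu}$, and let $$E_{\alpha\beta}=W_{\alpha\mu\nu\beta}n^\mu n^\nu,\qquad B_{\alpha\beta}=W^*{}_{\alpha\mu\nu\beta}n^\mu n^\nu$$ be its electric and magnetic parts, with components $E_{ij}$, $B_{ij}$ on $\Sigma$ (obtained by restricting both arguments to tangent vectors of $\Sigma$). Then, at every point of $\Sigma$ and in all local coordinates on $M$ and on $\Sigma$, $$E_{ij}=-{}^{3}R_{ij}-K\,K_{ij}+K_{ik}K^{k}{}_{j},$$ and, when the coordinates are compatibly oriented, $$B_{ij}=\varepsilon_i{}^{kl}D_lK_{kj}.$$ Here the antisymmetric tensors on $M$ and $\Sigma$ are normalised by $\sqrt{|g|}\,\varepsilon^{1234}=1$ and $\sqrt{\gamma}\,\varepsilon^{123}=1$, and the coordinates are compatibly oriented if the frame $(\partial_1,\partial_2,\partial_3,n)$, formed from the coordinate vectors of $\Sigma$ and then the normal, is positively oriented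 in the coordinates $(y^1,y^2,y^3,y^4)$ of $M$. -/

import Mathlib

open scoped Manifold ContDiff
open Bundle

noncomputable section

/-! ### Tensor calculus in local coordinates

A metric in local coordinates is a function `G` from (an open subset of) `ℝᵈ` to `d × d` matrices;
`G x i j` is the component `g_{ij}` at the point with coordinates `x`. -/

namespace Coord

variable {d : ℕ}

/-- The partial derivative `∂ᵢ f` at `x`. -/
def pd (i : Fin d) (f : EuclideanSpace ℝ (Fin d) → ℝ) (x : EuclideanSpace ℝ (Fin d)) : ℝ :=
  fderiv ℝ f x (EuclideanSpace.single i 1)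

/-- Christoffel symbols `Γᵏᵢⱼ = ½ gᵏˡ (∂ᵢ g_{lj} + ∂ⱼ g_{li} - ∂ₗ g_{ij})`. -/
def christoffel (G : EuclideanSpace ℝ (Fin d) → Matrix (Fin d) (Fin d) ℝ)
    (x : EuclideanSpace ℝ (Fin d)) (k i j : Fin d) : ℝ :=
  (1 / 2) * ∑ l, (G x)⁻¹ k l *
    (pd i (fun y => G y l j) x + pd j (fun y => G y l i) x - pd l (fun y => G y i j) x)

/-- The Riemann tensor `Rᵃ_{bmn}`, with the sign for which
`(∇ₘ∇ₙ - ∇ₙ∇ₘ) vᵃ = Rᵃ_{bmn} vᵇ`. -/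
def riemannUp (G : EuclideanSpace ℝ (Fin d) → Matrix (Fin d) (Fin d) ℝ)
    (x : EuclideanSpace ℝ (Fin d)) (a b m n : Fin d) : ℝ :=
  pd m (fun y => christoffel G y a n b) x - pd n (fun y => christoffel G y a m b) x
    + ∑ l, (christoffel G x a m l * christoffel G x l n b
      - christoffel G x a n l * christoffel G x l m b)

/-- The Riemann tensor with all indices lowered, `R_{abmn} = g_{ac} Rᶜ_{bmn}`. -/
def riemann (G : EuclideanSpace ℝ (Fin d) → Matrix (Fin d) (Fin d) ℝ)
    (x : EuclideanSpace ℝ (Fin d)) (a b m n : Fin d) : ℝ :=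
  ∑ c, G x a c * riemannUp G x c b m n

/-- The Ricci tensor `R_{bn} = Rᵃ_{ban}`. -/
def ricci (G : EuclideanSpace ℝ (Fin d) → Matrix (Fin d) (Fin d) ℝ)
    (x : EuclideanSpace ℝ (Fin d)) (b n : Fin d) : ℝ :=
  ∑ a, riemannUp G x a b a n

/-- The scalar curvature `R = gᵃᵇ R_{ab}`. -/
def scalarCurvature (G : EuclideanSpace ℝ (Fin d) → Matrix (Fin d) (Fin d) ℝ)
    (x : EuclideanSpace ℝ (Fin d)) : ℝ :=
  ∑ a, ∑ b, (G x)⁻¹ a b * ricci G x a b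

/-- The permutation symbol: the sign of `a` if `a` is a permutation of the indices, and `0` if two
of the indices coincide (the determinant of the matrix whose `k`-th row is the `a k`-th standard
basis vector). -/
def permSymbol (a : Fin d → Fin d) : ℝ :=
  (Matrix.of fun k l => if a k = l then (1 : ℝ) else 0).det

/-- The antisymmetric tensor with upper indices, normalised by `√|g| ε^{12…d} = 1`. -/
def epsUp (G : EuclideanSpace ℝ (Fin d) → Matrix (Fin d) (Fin d) ℝ)
    (x : EuclideanSpace ℝ (Fin d)) (a : Fin d → Fin d) : ℝ :=
  permSymbol a / √|(G x).det|

/-- The covariant derivative `Dₗ T_{kj} = ∂ₗ T_{kj} - Γᵐₗₖ T_{mj} - Γᵐₗⱼ T_{km}` of a tensor field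
with two lower indices. -/
def covDeriv (G : EuclideanSpace ℝ (Fin d) → Matrix (Fin d) (Fin d) ℝ)
    (T : EuclideanSpace ℝ (Fin d) → Matrix (Fin d) (Fin d) ℝ)
    (x : EuclideanSpace ℝ (Fin d)) (l k j : Fin d) : ℝ :=
  pd l (fun y => T y k j) x
    - ∑ m, (christoffel G x m l k * T x m j + christoffel G x m l j * T x k m)

/-! The following are specific to dimension four. -/

/-- The Weyl tensor in dimension four,
`W_{abmn} = R_{abmn} - (g_{a[m} R_{n]b} - g_{b[m} R_{n]a}) + ⅓ R g_{a[m} g_{n]b}`. -/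
def weyl (G : EuclideanSpace ℝ (Fin 4) → Matrix (Fin 4) (Fin 4) ℝ)
    (x : EuclideanSpace ℝ (Fin 4)) (a b m n : Fin 4) : ℝ :=
  riemann G x a b m n
    - ((1 / 2) * (G x a m * ricci G x n b - G x a n * ricci G x m b)
      - (1 / 2) * (G x b m * ricci G x n a - G x b n * ricci G x m a))
    + (1 / 3) * scalarCurvature G x * ((1 / 2) * (G x a m * G x n b - G x a n * G x m b))

/-- The dual of the Weyl tensor in the second pair of indices,
`W*_{abmn} = ½ W_{abpq} ε^{pq}_{mn}`. -/
def weylDual (G : EuclideanSpace ℝ (Fin 4) → Matrix (Fin 4) (Fin 4) ℝ)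
    (x : EuclideanSpace ℝ (Fin 4)) (a b m n : Fin 4) : ℝ :=
  (1 / 2) * ∑ p, ∑ q, weyl G x a b p q *
    ∑ r, ∑ s, epsUp G x ![p, q, r, s] * G x r m * G x s n

/-- The electric part `E_{ab} = W_{amnb} uᵐ uⁿ` of the Weyl tensor with respect to the vector with
components `u`. -/
def electric (G : EuclideanSpace ℝ (Fin 4) → Matrix (Fin 4) (Fin 4) ℝ)
    (x : EuclideanSpace ℝ (Fin 4)) (u : Fin 4 → ℝ) (a b : Fin 4) : ℝ :=
  ∑ m, ∑ n, weyl G x a m n b * u m * u n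

/-- The magnetic part `B_{ab} = W*_{amnb} uᵐ uⁿ` of the Weyl tensor with respect to the vector with
components `u`. -/
def magnetic (G : EuclideanSpace ℝ (Fin 4) → Matrix (Fin 4) (Fin 4) ℝ)
    (x : EuclideanSpace ℝ (Fin 4)) (u : Fin 4 → ℝ) (a b : Fin 4) : ℝ :=
  ∑ m, ∑ n, weylDual G x a m n b * u m * u n

end Coord

/-- The components `g_{ij} = g(∂ᵢ, ∂ⱼ)`, in the chart `e`, of a field `g` of bilinear forms on the
tangent spaces of a `d`-dimensional manifold, as functions of the coordinates. -/
def metricComponents {d : ℕ} {M : Type*} [TopologicalSpace M]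
    [ChartedSpace (EuclideanSpace ℝ (Fin d)) M]
    (g : (p : M) → TangentSpace (𝓡 d) p → TangentSpace (𝓡 d) p → ℝ)
    (e : OpenPartialHomeomorph M (EuclideanSpace ℝ (Fin d))) :
    EuclideanSpace ℝ (Fin d) → Matrix (Fin d) (Fin d) ℝ :=
  fun x => Matrix.of fun i j =>
    g (e.symm x) (mfderiv (𝓡 d) (𝓡 d) e.symm x (EuclideanSpace.single i (1 : ℝ)))
      (mfderiv (𝓡 d) (𝓡 d) e.symm x (EuclideanSpace.single j (1 : ℝ)))

/-- A smooth Lorentzian metric of signature `(-,+,+,+)` on a four-dimensional manifold. -/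
structure LorentzMetric (M : Type*) [TopologicalSpace M]
    [ChartedSpace (EuclideanSpace ℝ (Fin 4)) M] [IsManifold (𝓡 4) ∞ M] where
  /-- The bilinear form on each tangent space. -/
  form (p : M) : TangentSpace (𝓡 4) p →L[ℝ] TangentSpace (𝓡 4) p →L[ℝ] ℝ
  symm (p : M) (v w : TangentSpace (𝓡 4) p) : form p v w = form p w v
  signature (p : M) : ∃ b : Module.Basis (Fin 4) ℝ (TangentSpace (𝓡 4) p),
    ∀ i j, form p (b i) (b j) = Matrix.diagonal ![(-1 : ℝ), 1, 1, 1] i j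
  contMDiff : ContMDiff (𝓡 4)
    ((𝓡 4).prod 𝓘(ℝ, EuclideanSpace ℝ (Fin 4) →L[ℝ] EuclideanSpace ℝ (Fin 4) →L[ℝ] ℝ)) ∞
    (fun p : M => TotalSpace.mk'
      (EuclideanSpace ℝ (Fin 4) →L[ℝ] EuclideanSpace ℝ (Fin 4) →L[ℝ] ℝ) p (form p))

/-- The components `g_{μν}` of the spacetime metric in the chart `e`. -/
def LorentzMetric.components {M : Type*} [TopologicalSpace M]
    [ChartedSpace (EuclideanSpace ℝ (Fin 4)) M] [IsManifold (𝓡 4) ∞ M]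
    (g : LorentzMetric M) (e : OpenPartialHomeomorph M (EuclideanSpace ℝ (Fin 4))) :
    EuclideanSpace ℝ (Fin 4) → Matrix (Fin 4) (Fin 4) ℝ :=
  metricComponents (fun p v w => g.form p v w) e

/-- The vacuum Einstein equations `R_{μν} - ½ R g_{μν} = 0` (in every chart of the smooth
structure, at every point). -/
def LorentzMetric.IsVacuum {M : Type*} [TopologicalSpace M]
    [ChartedSpace (EuclideanSpace ℝ (Fin 4)) M] [IsManifold (𝓡 4) ∞ M]
    (g : LorentzMetric M) : Prop :=
  ∀ e ∈ IsManifold.maximalAtlas (𝓡 4) ∞ M, ∀ x ∈ e.target, ∀ μ ν : Fin 4,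
    Coord.ricci (g.components e) x μ ν
      - (1 / 2) * Coord.scalarCurvature (g.components e) x
        * g.components e x μ ν = 0

/-- A spatial hypersurface of the spacetime `(M, g)`: a three-dimensional smooth manifold `S` with a
smooth map `S → M` for which the induced symmetric form on `S` is positive definite (in particular,
the map is an immersion), together with a smooth unit normal vector field along it. -/
structure SpatialHypersurface {M : Type*} [TopologicalSpace M]
    [ChartedSpace (EuclideanSpace ℝ (Fin 4)) M] [IsManifold (𝓡 4) ∞ M]
    (g : LorentzMetric M) (S : Type*) [TopologicalSpace S]
    [ChartedSpace (EuclideanSpace ℝ (Fin 3)) S] [IsManifold (𝓡 3) ∞ S] where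
  /-- The immersion of the hypersurface in spacetime. -/
  imm : S → M
  contMDiff_imm : ContMDiff (𝓡 3) (𝓡 4) ∞ imm
  spacelike (p : S) (v : TangentSpace (𝓡 3) p) (hv : v ≠ 0) :
    0 < g.form (imm p) (mfderiv (𝓡 3) (𝓡 4) imm p v) (mfderiv (𝓡 3) (𝓡 4) imm p v)
  /-- The unit normal. -/
  normal (p : S) : TangentSpace (𝓡 4) (imm p)
  contMDiff_normal : ContMDiff (𝓡 3) (𝓡 4).tangent ∞
    (fun p : S => (⟨imm p, normal p⟩ : TangentBundle (𝓡 4) M))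
  normal_unit (p : S) : g.form (imm p) (normal p) (normal p) = -1
  normal_orthogonal (p : S) (v : TangentSpace (𝓡 3) p) :
    g.form (imm p) (normal p) (mfderiv (𝓡 3) (𝓡 4) imm p v) = 0

namespace SpatialHypersurface

variable {M : Type*} [TopologicalSpace M] [ChartedSpace (EuclideanSpace ℝ (Fin 4)) M]
  [IsManifold (𝓡 4) ∞ M] {g : LorentzMetric M}
  {S : Type*} [TopologicalSpace S] [ChartedSpace (EuclideanSpace ℝ (Fin 3)) S]
  [IsManifold (𝓡 3) ∞ S]

/-- The induced metric `γ` on the hypersurface. -/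
def inducedForm (h : SpatialHypersurface g S) (p : S) (v w : TangentSpace (𝓡 3) p) : ℝ :=
  g.form (h.imm p) (mfderiv (𝓡 3) (𝓡 4) h.imm p v) (mfderiv (𝓡 3) (𝓡 4) h.imm p w)

/-! In the rest, `e` is a chart of spacetime with coordinates `y^μ`, `f` a chart of the hypersurface
with coordinates `xⁱ`, and the fields along the hypersurface are functions of `x`. -/

/-- The induced metric `γ_{ij}` in the chart `f`. -/
def gamma (h : SpatialHypersurface g S) (f : OpenPartialHomeomorph S (EuclideanSpace ℝ (Fin 3))) :
    EuclideanSpace ℝ (Fin 3) → Matrix (Fin 3) (Fin 3) ℝ :=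
  metricComponents h.inducedForm f

/-- The immersion in coordinates, `x ↦ y(x)`. -/
def immCoord (h : SpatialHypersurface g S) (e : OpenPartialHomeomorph M (EuclideanSpace ℝ (Fin 4)))
    (f : OpenPartialHomeomorph S (EuclideanSpace ℝ (Fin 3))) (x : EuclideanSpace ℝ (Fin 3)) :
    EuclideanSpace ℝ (Fin 4) :=
  e (h.imm (f.symm x))

/-- The components `∂y^μ/∂xⁱ` of the tangent vectors to the hypersurface. -/
def tangentComp (h : SpatialHypersurface g S)
    (e : OpenPartialHomeomorph M (EuclideanSpace ℝ (Fin 4)))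
    (f : OpenPartialHomeomorph S (EuclideanSpace ℝ (Fin 3))) (x : EuclideanSpace ℝ (Fin 3))
    (i : Fin 3) (μ : Fin 4) : ℝ :=
  Coord.pd i (fun z => h.immCoord e f z μ) x

/-- The components `n^μ` of the unit normal. -/
def normalUp (h : SpatialHypersurface g S) (e : OpenPartialHomeomorph M (EuclideanSpace ℝ (Fin 4)))
    (f : OpenPartialHomeomorph S (EuclideanSpace ℝ (Fin 3))) (x : EuclideanSpace ℝ (Fin 3))
    (μ : Fin 4) : ℝ :=
  (show EuclideanSpace ℝ (Fin 4) from
    mfderiv (𝓡 4) (𝓡 4) e (h.imm (f.symm x)) (h.normal (f.symm x))) μ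

/-- The components `n_μ = g_{μν} n^ν`. -/
def normalDown (h : SpatialHypersurface g S)
    (e : OpenPartialHomeomorph M (EuclideanSpace ℝ (Fin 4)))
    (f : OpenPartialHomeomorph S (EuclideanSpace ℝ (Fin 3))) (x : EuclideanSpace ℝ (Fin 3))
    (μ : Fin 4) : ℝ :=
  ∑ ν, g.components e (h.immCoord e f x) μ ν * h.normalUp e f x ν

/-- The extrinsic curvature `K_{ij} = - (∂y^μ/∂xⁱ) (∂y^ν/∂xʲ) ∇_μ n_ν`, where the derivative of `n`
along the hypersurface is `(∂y^μ/∂xⁱ) ∇_μ n_ν = ∂ᵢ n_ν - Γ^λ_{μν} (∂y^μ/∂xⁱ) n_λ`. -/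
def extrinsicCurvature (h : SpatialHypersurface g S)
    (e : OpenPartialHomeomorph M (EuclideanSpace ℝ (Fin 4)))
    (f : OpenPartialHomeomorph S (EuclideanSpace ℝ (Fin 3))) :
    EuclideanSpace ℝ (Fin 3) → Matrix (Fin 3) (Fin 3) ℝ :=
  fun x => Matrix.of fun i j =>
    - ∑ ν, h.tangentComp e f x j ν *
      (Coord.pd i (fun z => h.normalDown e f z ν) x
        - ∑ l, ∑ μ, Coord.christoffel (g.components e) (h.immCoord e f x) l μ ν
            * h.tangentComp e f x i μ * h.normalDown e f x l)

/-- The components `E_{ij}` on the hypersurface of the electric part of the Weyl tensor. -/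
def electricPart (h : SpatialHypersurface g S)
    (e : OpenPartialHomeomorph M (EuclideanSpace ℝ (Fin 4)))
    (f : OpenPartialHomeomorph S (EuclideanSpace ℝ (Fin 3))) (x : EuclideanSpace ℝ (Fin 3))
    (i j : Fin 3) : ℝ :=
  ∑ α, ∑ β, h.tangentComp e f x i α * h.tangentComp e f x j β *
    Coord.electric (g.components e) (h.immCoord e f x) (h.normalUp e f x) α β

/-- The components `B_{ij}` on the hypersurface of the magnetic part of the Weyl tensor. -/
def magneticPart (h : SpatialHypersurface g S)
    (e : OpenPartialHomeomorph M (EuclideanSpace ℝ (Fin 4)))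
    (f : OpenPartialHomeomorph S (EuclideanSpace ℝ (Fin 3))) (x : EuclideanSpace ℝ (Fin 3))
    (i j : Fin 3) : ℝ :=
  ∑ α, ∑ β, h.tangentComp e f x i α * h.tangentComp e f x j β *
    Coord.magnetic (g.components e) (h.immCoord e f x) (h.normalUp e f x) α β

/-- The orientations of the two charts are compatible at `x`: the frame `(∂₁, ∂₂, ∂₃, n)` is
positively oriented in the spacetime chart. -/
def Compatible (h : SpatialHypersurface g S)
    (e : OpenPartialHomeomorph M (EuclideanSpace ℝ (Fin 4)))
    (f : OpenPartialHomeomorph S (EuclideanSpace ℝ (Fin 3))) (x : EuclideanSpace ℝ (Fin 3)) : Prop :=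
  0 < (Matrix.of ![h.tangentComp e f x 0, h.tangentComp e f x 1, h.tangentComp e f x 2,
    h.normalUp e f x]).det

end SpatialHypersurface

end

/-!
In local coordinates a spatial hypersurface is a map `Y` from an open subset of `ℝ³` into a
coordinate domain of spacetime, together with a unit normal `N` along it. The Levi-Civita connection
of the spacetime metric pulls back along `Y` to a covariant derivative `∇ᵢ` of vector fields along
`Y` (`Coord.covAlong`). It is compatible with the metric (`Coord.IsMetricOn.pd_bil`), it is
torsion-free in the sense that `∇ᵢ∂ⱼY = ∇ⱼ∂ᵢY` (`Coord.IsMetricOn.covAlong_tangent_comm`), and its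
curvature is the pullback of the Riemann tensor (`Coord.IsMetricOn.covAlong_commutator`).

These three facts give the Gauss formula `∇ᵢ∂ⱼY = Γᵏᵢⱼ ∂ₖY - Kᵢⱼ N`, where `Γ` belongs to the
induced metric `γ`. Pairing the commutator `∇ᵢ∇ⱼ∂ₖY - ∇ⱼ∇ᵢ∂ₖY` with `∂ₗY` and with `N`, and moving
the outer derivative across the metric, then yields the Gauss equation
`R(∂ₗ, ∂ₖ, ∂ᵢ, ∂ⱼ) = ³R_{lkij} + K_{li} K_{kj} - K_{lj} K_{ki}` (`Coord.IsHypersurface.gauss`) and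
the Codazzi equation `R(N, ∂ₖ, ∂ᵢ, ∂ⱼ) = Dᵢ K_{jk} - Dⱼ K_{ik}` (`Coord.IsHypersurface.codazzi`).

In vacuum the Ricci tensor vanishes, so that the Weyl tensor is the Riemann tensor. As the inverse
metric is `γ^{kl} ∂ₖY ∂ₗY - N N` (`Coord.IsAdapted.inv_apply`), the vanishing of `Ric(∂ᵢ, ∂ⱼ)` turns
`E_{ij} = R(∂ᵢ, N, N, ∂ⱼ)` into minus the trace of the Gauss equation, which is the first formula.

For the magnetic part, contracting `ε` with the normal leaves the volume tensor of the hypersurface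
(`Coord.IsAdapted.sum_eps`): in the frame `(∂₁, ∂₂, ∂₃, N)` the permutation symbol is multiplied by
the determinant of the frame, and that determinant is `√γ / √|g|` when the orientations agree. Hence
`B_{ij} = -½ C_{ikl} ε^{kl}_j` with `C_{ikl} = R(N, ∂ᵢ, ∂ₖ, ∂ₗ)`, whereas the Codazzi equation
identifies `ε_i^{kl} Dₗ K_{kj}` with `-½ C_{jkl} ε^{kl}_i`. The two agree because `C` has vanishing
trace, by `Ric(N, ∂ₗ) = 0` (the momentum constraint), and the dual of such a tensor is symmetric
(`Coord.dual_symm`).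
-/

noncomputable section

namespace Coord

/-! ### Partial derivatives of smooth functions -/

section PartialDerivatives

variable {d m : ℕ} {V : Set (EuclideanSpace ℝ (Fin m))} {x : EuclideanSpace ℝ (Fin m)}

theorem differentiableAt_of_contDiffOn {F : Type*} [NormedAddCommGroup F] [NormedSpace ℝ F]
    (hV : IsOpen V) {u : EuclideanSpace ℝ (Fin m) → F} (hu : ContDiffOn ℝ ∞ u V) (hx : x ∈ V) :
    DifferentiableAt ℝ u x :=
  (hu.contDiffAt (hV.mem_nhds hx)).differentiableAt (by simp)

theorem contDiffOn_pd (hV : IsOpen V) {u : EuclideanSpace ℝ (Fin m) → ℝ}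
    (hu : ContDiffOn ℝ ∞ u V) (i : Fin m) : ContDiffOn ℝ ∞ (fun z => pd i u z) V :=
  (hu.fderiv_of_isOpen hV (by simp)).clm_apply contDiffOn_const

theorem pd_congr (hV : IsOpen V) {u v : EuclideanSpace ℝ (Fin m) → ℝ}
    (h : ∀ z ∈ V, u z = v z) (hx : x ∈ V) (i : Fin m) : pd i u x = pd i v x := by
  have : u =ᶠ[nhds x] v := Filter.eventuallyEq_of_mem (hV.mem_nhds hx) h
  simp only [pd, this.fderiv_eq]

@[simp] theorem pd_const (i : Fin m) (c : ℝ) : pd i (fun _ => c) x = 0 := by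
  simp [pd]

theorem pd_add (i : Fin m) {u v : EuclideanSpace ℝ (Fin m) → ℝ}
    (hu : DifferentiableAt ℝ u x) (hv : DifferentiableAt ℝ v x) :
    pd i (fun z => u z + v z) x = pd i u x + pd i v x := by
  simp [pd, fderiv_fun_add hu hv]

theorem pd_mul (i : Fin m) {u v : EuclideanSpace ℝ (Fin m) → ℝ}
    (hu : DifferentiableAt ℝ u x) (hv : DifferentiableAt ℝ v x) :
    pd i (fun z => u z * v z) x = pd i u x * v x + u x * pd i v x := by
  simp [pd, fderiv_fun_mul hu hv]; ring

theorem pd_sum {ι : Type*} (s : Finset ι) (i : Fin m) {u : ι → EuclideanSpace ℝ (Fin m) → ℝ}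
    (hu : ∀ k ∈ s, DifferentiableAt ℝ (u k) x) :
    pd i (fun z => ∑ k ∈ s, u k z) x = ∑ k ∈ s, pd i (u k) x := by
  simp [pd, fderiv_fun_sum hu]

theorem pd_apply (i : Fin m) {Y : EuclideanSpace ℝ (Fin m) → EuclideanSpace ℝ (Fin d)}
    (hY : DifferentiableAt ℝ Y x) (μ : Fin d) :
    pd i (fun z => Y z μ) x = (fderiv ℝ Y x (EuclideanSpace.single i 1)) μ := by
  have := ((EuclideanSpace.proj μ : EuclideanSpace ℝ (Fin d) →L[ℝ] ℝ).hasFDerivAt.comp x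
    hY.hasFDerivAt).fderiv
  exact congrArg (fun L => L (EuclideanSpace.single i 1)) this

/-- The chain rule. -/
theorem pd_comp (i : Fin m) {Y : EuclideanSpace ℝ (Fin m) → EuclideanSpace ℝ (Fin d)}
    {φ : EuclideanSpace ℝ (Fin d) → ℝ} (hφ : DifferentiableAt ℝ φ (Y x))
    (hY : DifferentiableAt ℝ Y x) :
    pd i (fun z => φ (Y z)) x = ∑ μ, pd μ φ (Y x) * pd i (fun z => Y z μ) x := by
  have hsum : fderiv ℝ Y x (EuclideanSpace.single i 1)
      = ∑ μ, pd i (fun z => Y z μ) x • EuclideanSpace.single μ (1 : ℝ) := by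
    ext ν
    simp [pd_apply i hY, Finset.sum_apply, Pi.single_apply]
  have h := congrArg (fun L => L (EuclideanSpace.single i 1))
    (hφ.hasFDerivAt.comp x hY.hasFDerivAt).fderiv
  have h' : pd i (fun z => φ (Y z)) x
      = fderiv ℝ φ (Y x) (fderiv ℝ Y x (EuclideanSpace.single i 1)) := h
  rw [h', hsum]
  simp [pd, mul_comm]

/-- Second partial derivatives commute. -/
theorem pd_comm (hV : IsOpen V) {u : EuclideanSpace ℝ (Fin m) → ℝ} (hu : ContDiffOn ℝ ∞ u V)
    (hx : x ∈ V) (i j : Fin m) :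
    pd i (fun z => pd j u z) x = pd j (fun z => pd i u z) x := by
  have hd : DifferentiableAt ℝ (fderiv ℝ u) x :=
    differentiableAt_of_contDiffOn hV (hu.fderiv_of_isOpen hV (by simp)) hx
  have key (a b : Fin m) : pd a (fun z => pd b u z) x
      = fderiv ℝ (fderiv ℝ u) x (EuclideanSpace.single a 1) (EuclideanSpace.single b 1) := by
    simp only [pd]
    rw [fderiv_clm_apply hd (differentiableAt_const _)]
    simp
  have hs := (hu.contDiffAt (hV.mem_nhds hx)).isSymmSndFDerivAt (by
    simpa using (WithTop.coe_le_coe.2 le_top : ((2 : ℕ∞) : WithTop ℕ∞) ≤ ∞))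
  rw [key, key, hs.eq]

end PartialDerivatives

/-! ### Smooth dependence of determinants and inverse matrices -/

section Matrices

variable {F : Type*} [NormedAddCommGroup F] [NormedSpace ℝ F] {d : ℕ} {U : Set F}
  {G : F → Matrix (Fin d) (Fin d) ℝ}

theorem contDiffOn_det (hG : ∀ i j, ContDiffOn ℝ ∞ (fun y => G y i j) U) :
    ContDiffOn ℝ ∞ (fun y => (G y).det) U := by
  simp only [Matrix.det_apply']
  exact ContDiffOn.sum fun σ _ => contDiffOn_const.mul (contDiffOn_prod fun i _ => hG _ _)

theorem contDiffOn_inv (hG : ∀ i j, ContDiffOn ℝ ∞ (fun y => G y i j) U)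
    (hdet : ∀ y ∈ U, (G y).det ≠ 0) (i j : Fin d) :
    ContDiffOn ℝ ∞ (fun y => (G y)⁻¹ i j) U := by
  simp only [Matrix.inv_def, Matrix.smul_apply, smul_eq_mul, Ring.inverse_eq_inv',
    Matrix.adjugate_apply]
  refine ((contDiffOn_det hG).inv hdet).mul (contDiffOn_det fun k l => ?_)
  simp only [Matrix.updateRow_apply]
  by_cases hk : k = j
  · simpa [hk] using contDiffOn_const
  · simpa [hk] using hG k l

end Matrices

/-! ### Symmetries of the Christoffel symbols and of the Riemann tensor -/

/-- `G` is a smooth pseudo-Riemannian metric (of any signature) on the open set `U` of `ℝᵈ`. -/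
structure IsMetricOn {d : ℕ} (G : EuclideanSpace ℝ (Fin d) → Matrix (Fin d) (Fin d) ℝ)
    (U : Set (EuclideanSpace ℝ (Fin d))) : Prop where
  isOpen : IsOpen U
  smooth (i j : Fin d) : ContDiffOn ℝ ∞ (fun y => G y i j) U
  symm (y) (hy : y ∈ U) (i j : Fin d) : G y i j = G y j i
  det_ne (y) (hy : y ∈ U) : (G y).det ≠ 0

/-- Christoffel symbols of the first kind, `Γ_{aij} = ½ (∂ᵢ g_{aj} + ∂ⱼ g_{ai} - ∂ₐ g_{ij})`. -/
def christoffelLow {d : ℕ} (G : EuclideanSpace ℝ (Fin d) → Matrix (Fin d) (Fin d) ℝ)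
    (x : EuclideanSpace ℝ (Fin d)) (a i j : Fin d) : ℝ :=
  (1 / 2) * (pd i (fun y => G y a j) x + pd j (fun y => G y a i) x - pd a (fun y => G y i j) x)

namespace IsMetricOn

variable {d : ℕ} {G : EuclideanSpace ℝ (Fin d) → Matrix (Fin d) (Fin d) ℝ}
  {U : Set (EuclideanSpace ℝ (Fin d))} {y : EuclideanSpace ℝ (Fin d)}

theorem pd_symm (hG : IsMetricOn G U) (hy : y ∈ U) (k i j : Fin d) :
    pd k (fun z => G z i j) y = pd k (fun z => G z j i) y :=
  pd_congr hG.isOpen (fun z hz => hG.symm z hz i j) hy k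

theorem christoffel_symm (hG : IsMetricOn G U) (hy : y ∈ U) (k i j : Fin d) :
    christoffel G y k i j = christoffel G y k j i := by
  simp only [christoffel]
  congr 1
  refine Finset.sum_congr rfl fun l _ => ?_
  rw [hG.pd_symm hy l i j]
  ring

theorem contDiffOn_christoffel (hG : IsMetricOn G U) (k i j : Fin d) :
    ContDiffOn ℝ ∞ (fun z => christoffel G z k i j) U := by
  simp only [christoffel]
  refine contDiffOn_const.mul (ContDiffOn.sum fun l _ => ?_)
  exact (contDiffOn_inv hG.smooth hG.det_ne k l).mul
    (((contDiffOn_pd hG.isOpen (hG.smooth _ _) _).add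
      (contDiffOn_pd hG.isOpen (hG.smooth _ _) _)).sub
      (contDiffOn_pd hG.isOpen (hG.smooth _ _) _))

theorem contDiffOn_christoffelLow (hG : IsMetricOn G U) (k i j : Fin d) :
    ContDiffOn ℝ ∞ (fun z => christoffelLow G z k i j) U := by
  simp only [christoffelLow]
  exact contDiffOn_const.mul
    (((contDiffOn_pd hG.isOpen (hG.smooth _ _) _).add
      (contDiffOn_pd hG.isOpen (hG.smooth _ _) _)).sub
      (contDiffOn_pd hG.isOpen (hG.smooth _ _) _))

theorem sum_mul_inv (hG : IsMetricOn G U) (hy : y ∈ U) (a b : Fin d) :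
    ∑ c, G y a c * (G y)⁻¹ c b = if a = b then 1 else 0 := by
  have h := congrFun (congrFun (Matrix.mul_nonsing_inv (G y) (hG.det_ne y hy).isUnit) a) b
  rwa [Matrix.mul_apply, Matrix.one_apply] at h

theorem sum_inv_mul (hG : IsMetricOn G U) (hy : y ∈ U) (a b : Fin d) :
    ∑ c, (G y)⁻¹ a c * G y c b = if a = b then 1 else 0 := by
  have h := congrFun (congrFun (Matrix.nonsing_inv_mul (G y) (hG.det_ne y hy).isUnit) a) b
  rwa [Matrix.mul_apply, Matrix.one_apply] at h

theorem sum_metric_mul_christoffel (hG : IsMetricOn G U) (hy : y ∈ U) (a i j : Fin d) :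
    ∑ c, G y a c * christoffel G y c i j = christoffelLow G y a i j := by
  simp only [christoffel, Finset.mul_sum]
  rw [Finset.sum_comm]
  calc _ = ∑ l, (∑ c, G y a c * (G y)⁻¹ c l) * christoffelLow G y l i j := by
        refine Finset.sum_congr rfl fun l _ => ?_
        rw [Finset.sum_mul]
        refine Finset.sum_congr rfl fun c _ => ?_
        simp only [christoffelLow]; ring
    _ = _ := by simp [hG.sum_mul_inv hy]

/-- The metric is covariantly constant. -/
theorem pd_metric (hG : IsMetricOn G U) (hy : y ∈ U) (k i j : Fin d) :
    pd k (fun z => G z i j) y = christoffelLow G y i k j + christoffelLow G y j k i := by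
  simp only [christoffelLow]
  rw [hG.pd_symm hy k j i, hG.pd_symm hy i j k, hG.pd_symm hy j k i]
  ring

/-- The Riemann tensor in terms of the Christoffel symbols of the first kind. -/
theorem riemann_eq (hG : IsMetricOn G U) (hy : y ∈ U) (a b m n : Fin d) :
    riemann G y a b m n = pd m (fun z => christoffelLow G z a n b) y
      - pd n (fun z => christoffelLow G z a m b) y
      - ∑ c, (christoffelLow G y c m a * christoffel G y c n b
        - christoffelLow G y c n a * christoffel G y c m b) := by
  have hpd (m n : Fin d) : pd m (fun z => christoffelLow G z a n b) y
      = ∑ c, (christoffelLow G y a m c * christoffel G y c n b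
          + christoffelLow G y c m a * christoffel G y c n b
          + G y a c * pd m (fun z => christoffel G z c n b) y) := by
    rw [pd_congr hG.isOpen (fun z hz => (hG.sum_metric_mul_christoffel hz a n b).symm) hy m,
      pd_sum]
    · refine Finset.sum_congr rfl fun c _ => ?_
      rw [pd_mul, hG.pd_metric hy]
      · ring
      · exact differentiableAt_of_contDiffOn hG.isOpen (hG.smooth _ _) hy
      · exact differentiableAt_of_contDiffOn hG.isOpen (hG.contDiffOn_christoffel _ _ _) hy
    · intro c _
      exact differentiableAt_of_contDiffOn hG.isOpen
        ((hG.smooth _ _).mul (hG.contDiffOn_christoffel _ _ _)) hy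
  have hquad (m n : Fin d) : ∑ c, G y a c * ∑ l, christoffel G y c m l * christoffel G y l n b
      = ∑ c, christoffelLow G y a m c * christoffel G y c n b := by
    simp only [← hG.sum_metric_mul_christoffel hy a m, Finset.mul_sum, Finset.sum_mul]
    rw [Finset.sum_comm]
    simp only [mul_assoc]
  rw [hpd, hpd]
  simp only [riemann, riemannUp, mul_add, mul_sub, Finset.sum_add_distrib, Finset.sum_sub_distrib,
    hquad]
  ring

/-- The Riemann tensor is antisymmetric in its first pair of indices. -/
theorem riemann_antisymm (hG : IsMetricOn G U) (hy : y ∈ U) (a b m n : Fin d) :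
    riemann G y a b m n = - riemann G y b a m n := by
  have hlow (m n : Fin d) : ∑ c, christoffelLow G y c m a * christoffel G y c n b
      = ∑ c, christoffelLow G y c n b * christoffel G y c m a := by
    simp only [← hG.sum_metric_mul_christoffel hy, Finset.sum_mul]
    rw [Finset.sum_comm]
    refine Finset.sum_congr rfl fun c _ => Finset.sum_congr rfl fun e _ => ?_
    rw [hG.symm y hy e c]; ring
  have hpd (m n : Fin d) : pd m (fun z => christoffelLow G z a n b) y
      + pd m (fun z => christoffelLow G z b n a) y
      = pd m (fun z => pd n (fun w => G w a b) z) y := by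
    rw [← pd_add]
    · exact (pd_congr hG.isOpen (fun z hz => hG.pd_metric hz n a b) hy m).symm
    all_goals exact differentiableAt_of_contDiffOn hG.isOpen (hG.contDiffOn_christoffelLow _ _ _) hy
  have hcomm := pd_comm hG.isOpen (hG.smooth a b) hy m n
  have h1 := hpd m n
  have h2 := hpd n m
  have h3 := hlow m n
  have h4 := hlow n m
  rw [hG.riemann_eq hy, hG.riemann_eq hy]
  simp only [Finset.sum_sub_distrib]
  linarith

/-- Raising the first index of the Riemann tensor. -/
theorem riemannUp_eq (hG : IsMetricOn G U) (hy : y ∈ U) (a b m n : Fin d) :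
    riemannUp G y a b m n = ∑ c, (G y)⁻¹ a c * riemann G y c b m n := by
  simp only [riemann, Finset.mul_sum]
  rw [Finset.sum_comm]
  simp only [← mul_assoc, ← Finset.sum_mul, hG.sum_inv_mul hy]
  simp

end IsMetricOn

theorem riemann_antisymm_right {d : ℕ} (G : EuclideanSpace ℝ (Fin d) → Matrix (Fin d) (Fin d) ℝ)
    (y : EuclideanSpace ℝ (Fin d)) (a b m n : Fin d) :
    riemann G y a b m n = - riemann G y a b n m := by
  simp only [riemann, riemannUp, ← Finset.sum_neg_distrib, Finset.sum_sub_distrib]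
  refine Finset.sum_congr rfl fun c _ => ?_
  ring

/-! ### Covariant differentiation of vector fields along a map -/

/-- `Y` is a smooth map from the open set `V ⊆ ℝᵐ` to `U ⊆ ℝᵈ`. -/
structure IsSmoothMapOn {m d : ℕ} (Y : EuclideanSpace ℝ (Fin m) → EuclideanSpace ℝ (Fin d))
    (V : Set (EuclideanSpace ℝ (Fin m))) (U : Set (EuclideanSpace ℝ (Fin d))) : Prop where
  isOpen : IsOpen V
  smooth : ContDiffOn ℝ ∞ Y V
  mapsTo : Set.MapsTo Y V U

/-- The components `∂y^μ/∂xⁱ` of the coordinate vectors, pushed forward by `Y`. -/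
def tangent {m d : ℕ} (Y : EuclideanSpace ℝ (Fin m) → EuclideanSpace ℝ (Fin d))
    (x : EuclideanSpace ℝ (Fin m)) (i : Fin m) (μ : Fin d) : ℝ :=
  pd i (fun z => Y z μ) x

/-- The matrix `(Aᵢ)^μ_β = Γ^μ_{αβ} ∂y^α/∂xⁱ` of the Levi-Civita connection of `G`, pulled back
by `Y`. -/
def conn {m d : ℕ} (G : EuclideanSpace ℝ (Fin d) → Matrix (Fin d) (Fin d) ℝ)
    (Y : EuclideanSpace ℝ (Fin m) → EuclideanSpace ℝ (Fin d)) (i : Fin m)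
    (x : EuclideanSpace ℝ (Fin m)) (μ β : Fin d) : ℝ :=
  ∑ α, christoffel G (Y x) μ α β * tangent Y x i α

/-- The covariant derivative `(∇ᵢ v)^μ = ∂ᵢ v^μ + (Aᵢ)^μ_β v^β` of a vector field along `Y`. -/
def covAlong {m d : ℕ} (G : EuclideanSpace ℝ (Fin d) → Matrix (Fin d) (Fin d) ℝ)
    (Y : EuclideanSpace ℝ (Fin m) → EuclideanSpace ℝ (Fin d)) (i : Fin m)
    (v : EuclideanSpace ℝ (Fin m) → Fin d → ℝ) (x : EuclideanSpace ℝ (Fin m)) (μ : Fin d) : ℝ :=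
  pd i (fun z => v z μ) x + ∑ β, conn G Y i x μ β * v x β

/-- The bilinear form `A_{μν} u^μ v^ν`. -/
def bil {d : ℕ} (A : Matrix (Fin d) (Fin d) ℝ) (u v : Fin d → ℝ) : ℝ :=
  ∑ μ, ∑ ν, A μ ν * u μ * v ν

/-- The Riemann tensor `R_{abmn} uᵃ vᵇ wᵐ zⁿ` as a multilinear form. -/
def riemannForm {d : ℕ} (G : EuclideanSpace ℝ (Fin d) → Matrix (Fin d) (Fin d) ℝ)
    (y : EuclideanSpace ℝ (Fin d)) (u v w z : Fin d → ℝ) : ℝ :=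
  ∑ a, ∑ b, ∑ m, ∑ n, riemann G y a b m n * u a * v b * w m * z n

section

variable {m d : ℕ} {G : EuclideanSpace ℝ (Fin d) → Matrix (Fin d) (Fin d) ℝ}
  {U : Set (EuclideanSpace ℝ (Fin d))} {Y : EuclideanSpace ℝ (Fin m) → EuclideanSpace ℝ (Fin d)}
  {V : Set (EuclideanSpace ℝ (Fin m))} {x : EuclideanSpace ℝ (Fin m)}
  {v w : EuclideanSpace ℝ (Fin m) → Fin d → ℝ}

theorem bil_comm {A : Matrix (Fin d) (Fin d) ℝ} (hA : ∀ i j, A i j = A j i) (u v : Fin d → ℝ) :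
    bil A u v = bil A v u := by
  simp only [bil]
  rw [Finset.sum_comm]
  refine Finset.sum_congr rfl fun i _ => Finset.sum_congr rfl fun j _ => ?_
  rw [hA j i]; ring

theorem bil_eq_dotProduct (A : Matrix (Fin d) (Fin d) ℝ) (u v : Fin d → ℝ) :
    bil A u v = u ⬝ᵥ A.mulVec v := by
  simp only [bil, dotProduct, Matrix.mulVec, Finset.mul_sum]
  refine Finset.sum_congr rfl fun i _ => Finset.sum_congr rfl fun j _ => ?_
  ring

theorem IsSmoothMapOn.contDiffOn_apply (hY : IsSmoothMapOn Y V U) (μ : Fin d) :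
    ContDiffOn ℝ ∞ (fun z => Y z μ) V :=
  (EuclideanSpace.proj μ : EuclideanSpace ℝ (Fin d) →L[ℝ] ℝ).contDiff.comp_contDiffOn hY.smooth

theorem IsSmoothMapOn.contDiffOn_tangent (hY : IsSmoothMapOn Y V U) (i : Fin m) (μ : Fin d) :
    ContDiffOn ℝ ∞ (fun z => tangent Y z i μ) V :=
  contDiffOn_pd hY.isOpen (hY.contDiffOn_apply μ) i

theorem IsSmoothMapOn.contDiffOn_comp (hY : IsSmoothMapOn Y V U)
    {u : EuclideanSpace ℝ (Fin d) → ℝ} (hu : ContDiffOn ℝ ∞ u U) :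
    ContDiffOn ℝ ∞ (fun z => u (Y z)) V :=
  hu.comp hY.smooth hY.mapsTo

theorem IsSmoothMapOn.pd_comp (hY : IsSmoothMapOn Y V U) (hU : IsOpen U)
    {u : EuclideanSpace ℝ (Fin d) → ℝ} (hu : ContDiffOn ℝ ∞ u U) (hx : x ∈ V) (i : Fin m) :
    pd i (fun z => u (Y z)) x = ∑ μ, pd μ u (Y x) * tangent Y x i μ :=
  Coord.pd_comp i (differentiableAt_of_contDiffOn hU hu (hY.mapsTo hx))
    (differentiableAt_of_contDiffOn hY.isOpen hY.smooth hx)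

theorem IsMetricOn.contDiffOn_conn (hG : IsMetricOn G U) (hY : IsSmoothMapOn Y V U) (i : Fin m)
    (μ β : Fin d) : ContDiffOn ℝ ∞ (fun z => conn G Y i z μ β) V :=
  ContDiffOn.sum fun _ _ => (hY.contDiffOn_comp (hG.contDiffOn_christoffel _ _ _)).mul
    (hY.contDiffOn_tangent _ _)

theorem IsMetricOn.contDiffOn_covAlong (hG : IsMetricOn G U) (hY : IsSmoothMapOn Y V U) (i : Fin m)
    (hv : ∀ μ, ContDiffOn ℝ ∞ (fun z => v z μ) V) (μ : Fin d) :
    ContDiffOn ℝ ∞ (fun z => covAlong G Y i v z μ) V :=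
  (contDiffOn_pd hY.isOpen (hv μ) i).add
    (ContDiffOn.sum fun _ _ => (hG.contDiffOn_conn hY _ _ _).mul (hv _))

theorem IsMetricOn.contDiffOn_bil (hG : IsMetricOn G U) (hY : IsSmoothMapOn Y V U)
    (hv : ∀ μ, ContDiffOn ℝ ∞ (fun z => v z μ) V) (hw : ∀ μ, ContDiffOn ℝ ∞ (fun z => w z μ) V) :
    ContDiffOn ℝ ∞ (fun z => bil (G (Y z)) (v z) (w z)) V :=
  ContDiffOn.sum fun _ _ => ContDiffOn.sum fun _ _ =>
    ((hY.contDiffOn_comp (hG.smooth _ _)).mul (hv _)).mul (hw _)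

theorem IsMetricOn.pd_metric_comp (hG : IsMetricOn G U) (hY : IsSmoothMapOn Y V U) (hx : x ∈ V)
    (i : Fin m) (μ ν : Fin d) :
    pd i (fun z => G (Y z) μ ν) x
      = ∑ c, G (Y x) μ c * conn G Y i x c ν + ∑ c, G (Y x) ν c * conn G Y i x c μ := by
  have h (μ ν : Fin d) : ∑ c, G (Y x) μ c * conn G Y i x c ν
      = ∑ κ, christoffelLow G (Y x) μ κ ν * tangent Y x i κ := by
    simp only [conn, ← hG.sum_metric_mul_christoffel (hY.mapsTo hx), Finset.mul_sum,
      Finset.sum_mul]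
    rw [Finset.sum_comm]
    simp only [mul_assoc]
  rw [hY.pd_comp hG.isOpen (hG.smooth μ ν) hx, h, h, ← Finset.sum_add_distrib]
  refine Finset.sum_congr rfl fun κ _ => ?_
  rw [hG.pd_metric (hY.mapsTo hx)]
  ring

/-- Covariant differentiation along a map is compatible with the metric. -/
theorem IsMetricOn.pd_bil (hG : IsMetricOn G U) (hY : IsSmoothMapOn Y V U) (hx : x ∈ V)
    (hv : ∀ μ, ContDiffOn ℝ ∞ (fun z => v z μ) V) (hw : ∀ μ, ContDiffOn ℝ ∞ (fun z => w z μ) V)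
    (i : Fin m) :
    pd i (fun z => bil (G (Y z)) (v z) (w z)) x
      = bil (G (Y x)) (covAlong G Y i v x) (w x) + bil (G (Y x)) (v x) (covAlong G Y i w x) := by
  have dG (μ ν : Fin d) : DifferentiableAt ℝ (fun z => G (Y z) μ ν) x :=
    differentiableAt_of_contDiffOn hY.isOpen (hY.contDiffOn_comp (hG.smooth _ _)) hx
  have dv (μ : Fin d) : DifferentiableAt ℝ (fun z => v z μ) x :=
    differentiableAt_of_contDiffOn hY.isOpen (hv μ) hx
  have dw (μ : Fin d) : DifferentiableAt ℝ (fun z => w z μ) x :=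
    differentiableAt_of_contDiffOn hY.isOpen (hw μ) hx
  have hpd : pd i (fun z => bil (G (Y z)) (v z) (w z)) x
      = ∑ μ, ∑ ν, (G (Y x) μ ν * pd i (fun z => v z μ) x * w x ν
        + G (Y x) μ ν * v x μ * pd i (fun z => w z ν) x
        + (∑ c, G (Y x) μ c * conn G Y i x c ν) * v x μ * w x ν
        + (∑ c, G (Y x) ν c * conn G Y i x c μ) * v x μ * w x ν) := by
    simp only [bil]
    rw [pd_sum _ _ fun μ _ => DifferentiableAt.fun_sum fun ν _ =>
      ((dG μ ν).fun_mul (dv μ)).fun_mul (dw ν)]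
    refine Finset.sum_congr rfl fun μ _ => ?_
    rw [pd_sum _ _ fun ν _ => ((dG μ ν).fun_mul (dv μ)).fun_mul (dw ν)]
    refine Finset.sum_congr rfl fun ν _ => ?_
    rw [pd_mul i ((dG μ ν).fun_mul (dv μ)) (dw ν), pd_mul i (dG μ ν) (dv μ),
      hG.pd_metric_comp hY hx]
    ring
  have h1 : ∑ μ, ∑ ν, G (Y x) μ ν * (∑ β, conn G Y i x μ β * v x β) * w x ν
      = ∑ μ, ∑ ν, (∑ c, G (Y x) ν c * conn G Y i x c μ) * v x μ * w x ν := by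
    simp only [Finset.mul_sum, Finset.sum_mul]
    rw [Finset.sum_comm, Finset.sum_congr rfl fun ν _ => Finset.sum_comm, Finset.sum_comm]
    refine Finset.sum_congr rfl fun μ _ => Finset.sum_congr rfl fun ν _ =>
      Finset.sum_congr rfl fun c _ => ?_
    rw [hG.symm _ (hY.mapsTo hx) c ν]; ring
  have h2 : ∑ μ, ∑ ν, G (Y x) μ ν * v x μ * (∑ β, conn G Y i x ν β * w x β)
      = ∑ μ, ∑ ν, (∑ c, G (Y x) μ c * conn G Y i x c ν) * v x μ * w x ν := by
    simp only [Finset.mul_sum, Finset.sum_mul]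
    refine Finset.sum_congr rfl fun μ _ => ?_
    rw [Finset.sum_comm]
    refine Finset.sum_congr rfl fun ν _ => Finset.sum_congr rfl fun c _ => ?_
    ring
  rw [hpd]
  simp only [bil, covAlong, mul_add, add_mul, Finset.sum_add_distrib, h1, h2]
  ring

/-- The connection pulled back by `Y` is torsion-free: `∇ᵢ ∂ⱼY = ∇ⱼ ∂ᵢY`. -/
theorem IsMetricOn.covAlong_tangent_comm (hG : IsMetricOn G U) (hY : IsSmoothMapOn Y V U)
    (hx : x ∈ V) (i j : Fin m) (μ : Fin d) :
    covAlong G Y i (fun z => tangent Y z j) x μ = covAlong G Y j (fun z => tangent Y z i) x μ := by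
  simp only [covAlong, conn, Finset.sum_mul]
  congr 1
  · exact pd_comm hY.isOpen (hY.contDiffOn_apply μ) hx i j
  · rw [Finset.sum_comm]
    refine Finset.sum_congr rfl fun α _ => Finset.sum_congr rfl fun β _ => ?_
    rw [hG.christoffel_symm (hY.mapsTo hx) μ α β]; ring

/-- The curvature of the pulled back connection is the pullback of the Riemann tensor. -/
theorem IsMetricOn.curvature_conn (hG : IsMetricOn G U) (hY : IsSmoothMapOn Y V U)
    (hx : x ∈ V) (i j : Fin m) (μ β : Fin d) :
    pd i (fun z => conn G Y j z μ β) x - pd j (fun z => conn G Y i z μ β) x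
      + ∑ l, (conn G Y i x μ l * conn G Y j x l β - conn G Y j x μ l * conn G Y i x l β)
      = ∑ σ, ∑ α, riemannUp G (Y x) μ β σ α * tangent Y x i σ * tangent Y x j α := by
  have hpd (i j : Fin m) : pd i (fun z => conn G Y j z μ β) x
      = ∑ α, ∑ σ, pd σ (fun y => christoffel G y μ α β) (Y x) * tangent Y x i σ * tangent Y x j α
        + ∑ α, christoffel G (Y x) μ α β * pd i (fun z => tangent Y z j α) x := by
    simp only [conn]
    rw [pd_sum, ← Finset.sum_add_distrib]
    · refine Finset.sum_congr rfl fun α _ => ?_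
      rw [pd_mul, hY.pd_comp hG.isOpen (hG.contDiffOn_christoffel _ _ _) hx, Finset.sum_mul]
      · exact differentiableAt_of_contDiffOn hY.isOpen
          (hY.contDiffOn_comp (hG.contDiffOn_christoffel _ _ _)) hx
      · exact differentiableAt_of_contDiffOn hY.isOpen (hY.contDiffOn_tangent _ _) hx
    · intro α _
      exact differentiableAt_of_contDiffOn hY.isOpen
        ((hY.contDiffOn_comp (hG.contDiffOn_christoffel _ _ _)).mul (hY.contDiffOn_tangent _ _)) hx
  have hcomm (α : Fin d) : pd j (fun z => tangent Y z i α) x = pd i (fun z => tangent Y z j α) x :=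
    pd_comm hY.isOpen (hY.contDiffOn_apply α) hx j i
  have hquad (i j : Fin m) : ∑ l, conn G Y i x μ l * conn G Y j x l β
      = ∑ σ, ∑ α, (∑ l, christoffel G (Y x) μ σ l * christoffel G (Y x) l α β)
          * tangent Y x i σ * tangent Y x j α := by
    simp only [conn, Finset.sum_mul, Finset.mul_sum]
    rw [Finset.sum_congr rfl fun l _ => Finset.sum_comm, Finset.sum_comm]
    refine Finset.sum_congr rfl fun σ _ => ?_
    rw [Finset.sum_comm]
    refine Finset.sum_congr rfl fun α _ => Finset.sum_congr rfl fun l _ => ?_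
    ring
  rw [Finset.sum_sub_distrib, hquad, hquad, hpd, hpd]
  simp only [hcomm, riemannUp, add_mul, sub_mul, Finset.sum_add_distrib, Finset.sum_sub_distrib]
  rw [Finset.sum_comm (f := fun α σ => pd σ (fun y => christoffel G y μ α β) (Y x)
      * tangent Y x i σ * tangent Y x j α)]
  have h3 : ∑ σ, ∑ α, (∑ l, christoffel G (Y x) μ σ l * christoffel G (Y x) l α β)
          * tangent Y x j σ * tangent Y x i α
      = ∑ σ, ∑ α, (∑ l, christoffel G (Y x) μ α l * christoffel G (Y x) l σ β)
          * tangent Y x i σ * tangent Y x j α := by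
    rw [Finset.sum_comm]
    refine Finset.sum_congr rfl fun σ _ => Finset.sum_congr rfl fun α _ => ?_
    ring
  have h4 : ∑ α, ∑ σ, pd σ (fun y => christoffel G y μ α β) (Y x)
          * tangent Y x j σ * tangent Y x i α
      = ∑ σ, ∑ α, pd α (fun y => christoffel G y μ σ β) (Y x)
          * tangent Y x i σ * tangent Y x j α := by
    refine Finset.sum_congr rfl fun σ _ => Finset.sum_congr rfl fun α _ => ?_
    ring
  rw [h3, h4]
  ring

/-- The Ricci identity along a map:
`∇ᵢ∇ⱼ v - ∇ⱼ∇ᵢ v = R(·, v, ∂ᵢY, ∂ⱼY)`. -/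
theorem IsMetricOn.covAlong_commutator (hG : IsMetricOn G U) (hY : IsSmoothMapOn Y V U)
    (hx : x ∈ V) (hv : ∀ μ, ContDiffOn ℝ ∞ (fun z => v z μ) V) (i j : Fin m) (μ : Fin d) :
    covAlong G Y i (covAlong G Y j v) x μ - covAlong G Y j (covAlong G Y i v) x μ
      = ∑ β, ∑ σ, ∑ α,
        riemannUp G (Y x) μ β σ α * v x β * tangent Y x i σ * tangent Y x j α := by
  have hpd (i j : Fin m) : pd i (fun z => covAlong G Y j v z μ) x
      = pd i (fun z => pd j (fun w => v w μ) z) x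
        + ∑ β, (pd i (fun z => conn G Y j z μ β) x * v x β
          + conn G Y j x μ β * pd i (fun z => v z β) x) := by
    simp only [covAlong]
    rw [pd_add, pd_sum]
    · congr 1
      refine Finset.sum_congr rfl fun β _ => ?_
      rw [pd_mul]
      · exact differentiableAt_of_contDiffOn hY.isOpen (hG.contDiffOn_conn hY _ _ _) hx
      · exact differentiableAt_of_contDiffOn hY.isOpen (hv _) hx
    · intro β _
      exact differentiableAt_of_contDiffOn hY.isOpen ((hG.contDiffOn_conn hY _ _ _).mul (hv _)) hx
    · exact differentiableAt_of_contDiffOn hY.isOpen (contDiffOn_pd hY.isOpen (hv _) _) hx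
    · exact differentiableAt_of_contDiffOn hY.isOpen
        (ContDiffOn.sum fun _ _ => (hG.contDiffOn_conn hY _ _ _).mul (hv _)) hx
  have hquad (i j : Fin m) : ∑ l, conn G Y i x μ l * covAlong G Y j v x l
      = ∑ l, conn G Y i x μ l * pd j (fun z => v z l) x
        + ∑ β, (∑ l, conn G Y i x μ l * conn G Y j x l β) * v x β := by
    simp only [covAlong, mul_add, Finset.sum_add_distrib, Finset.mul_sum, Finset.sum_mul]
    congr 1
    rw [Finset.sum_comm]
    simp only [mul_assoc]
  have hR : ∑ β, ∑ σ, ∑ α,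
        riemannUp G (Y x) μ β σ α * v x β * tangent Y x i σ * tangent Y x j α
      = ∑ β, (pd i (fun z => conn G Y j z μ β) x - pd j (fun z => conn G Y i z μ β) x
      + ∑ l, (conn G Y i x μ l * conn G Y j x l β - conn G Y j x μ l * conn G Y i x l β))
        * v x β := by
    refine Finset.sum_congr rfl fun β _ => ?_
    rw [hG.curvature_conn hY hx]
    simp only [Finset.sum_mul]
    refine Finset.sum_congr rfl fun σ _ => Finset.sum_congr rfl fun α _ => ?_
    ring
  rw [hR, covAlong, covAlong, hpd, hpd, hquad, hquad, pd_comm hY.isOpen (hv μ) hx i j]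
  simp only [add_mul, sub_mul, Finset.sum_add_distrib, Finset.sum_sub_distrib]
  ring

/-- The Ricci identity along a map, paired with a vector `u`. -/
theorem IsMetricOn.riemannForm_eq (hG : IsMetricOn G U) (hY : IsSmoothMapOn Y V U)
    (hx : x ∈ V) (hv : ∀ μ, ContDiffOn ℝ ∞ (fun z => v z μ) V) (u : Fin d → ℝ) (i j : Fin m) :
    riemannForm G (Y x) u (v x) (tangent Y x i) (tangent Y x j)
      = bil (G (Y x)) (covAlong G Y i (covAlong G Y j v) x) u
        - bil (G (Y x)) (covAlong G Y j (covAlong G Y i v) x) u := by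
  have h : bil (G (Y x)) (covAlong G Y i (covAlong G Y j v) x) u
        - bil (G (Y x)) (covAlong G Y j (covAlong G Y i v) x) u
      = ∑ a, ∑ c, G (Y x) a c * u a * (covAlong G Y i (covAlong G Y j v) x c
        - covAlong G Y j (covAlong G Y i v) x c) := by
    simp only [bil, ← Finset.sum_sub_distrib]
    rw [Finset.sum_comm]
    refine Finset.sum_congr rfl fun a _ => Finset.sum_congr rfl fun c _ => ?_
    rw [hG.symm _ (hY.mapsTo hx) c a]; ring
  rw [h]
  simp only [hG.covAlong_commutator hY hx hv, riemannForm, riemann, Finset.mul_sum, Finset.sum_mul]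
  refine Finset.sum_congr rfl fun a _ => Eq.symm ?_
  rw [Finset.sum_comm]
  refine Finset.sum_congr rfl fun b _ => ?_
  rw [Finset.sum_comm]
  refine Finset.sum_congr rfl fun σ _ => ?_
  rw [Finset.sum_comm]
  refine Finset.sum_congr rfl fun α _ => Finset.sum_congr rfl fun c _ => ?_
  ring

end

/-! ### The frame adapted to a spatial hypersurface -/

section Frame

variable {A : Matrix (Fin 4) (Fin 4) ℝ} {H : Matrix (Fin 3) (Fin 3) ℝ} {T : Fin 3 → Fin 4 → ℝ}
  {N : Fin 4 → ℝ}

/-- The matrix with rows `T₁, T₂, T₃, N`. -/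
def frame (T : Fin 3 → Fin 4 → ℝ) (N : Fin 4 → ℝ) : Matrix (Fin 4) (Fin 4) ℝ :=
  Matrix.of ![T 0, T 1, T 2, N]

/-- The block diagonal matrix with blocks `H` and `-1`. -/
def lorentzBlock (H : Matrix (Fin 3) (Fin 3) ℝ) : Matrix (Fin 4) (Fin 4) ℝ :=
  !![H 0 0, H 0 1, H 0 2, 0; H 1 0, H 1 1, H 1 2, 0; H 2 0, H 2 1, H 2 2, 0; 0, 0, 0, -1]

/-- The vectors `T₁, T₂, T₃` have Gram matrix `H` for the symmetric form `A`, and `N` is a timelike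
unit vector orthogonal to them. -/
structure IsAdapted (A : Matrix (Fin 4) (Fin 4) ℝ) (H : Matrix (Fin 3) (Fin 3) ℝ)
    (T : Fin 3 → Fin 4 → ℝ) (N : Fin 4 → ℝ) : Prop where
  symm (i j : Fin 4) : A i j = A j i
  gram (i j : Fin 3) : bil A (T i) (T j) = H i j
  orth (i : Fin 3) : bil A N (T i) = 0
  unit : bil A N N = -1
  det_ne : H.det ≠ 0

theorem det_lorentzBlock (H : Matrix (Fin 3) (Fin 3) ℝ) : (lorentzBlock H).det = - H.det := by
  simp [lorentzBlock, Matrix.det_succ_row_zero, Fin.sum_univ_succ, Fin.succAbove]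
  ring

theorem lorentzBlock_mul (H H' : Matrix (Fin 3) (Fin 3) ℝ) (h : H * H' = 1) :
    lorentzBlock H * lorentzBlock H' = 1 := by
  have h' (i j : Fin 3) : H i 0 * H' 0 j + H i 1 * H' 1 j + H i 2 * H' 2 j
      = if i = j then 1 else 0 := by
    have := congrFun (congrFun h i) j
    simpa [Matrix.mul_apply, Fin.sum_univ_three, Matrix.one_apply] using this
  ext i j
  fin_cases i <;> fin_cases j <;>
    simp [lorentzBlock, Matrix.mul_apply, Fin.sum_univ_four, h']

theorem mul_frame_apply (A F : Matrix (Fin 4) (Fin 4) ℝ) (a b : Fin 4) :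
    (F * A * F.transpose) a b = bil A (F a) (F b) := by
  simp only [Matrix.mul_apply, Matrix.transpose_apply, bil, Finset.sum_mul]
  rw [Finset.sum_comm]
  refine Finset.sum_congr rfl fun i _ => Finset.sum_congr rfl fun j _ => ?_
  ring

namespace IsAdapted

theorem frame_mul (h : IsAdapted A H T N) :
    frame T N * A * (frame T N).transpose = lorentzBlock H := by
  have h' (i : Fin 3) : bil A (T i) N = 0 := by rw [bil_comm h.symm, h.orth]
  have h0 : frame T N 0 = T 0 := rfl
  have h1 : frame T N 1 = T 1 := rfl
  have h2 : frame T N 2 = T 2 := rfl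
  have h3 : frame T N 3 = N := rfl
  ext a b
  rw [mul_frame_apply]
  fin_cases a <;> fin_cases b <;>
    simp [h0, h1, h2, h3, lorentzBlock, h.gram, h.orth, h.unit, h']

theorem det_frame_sq (h : IsAdapted A H T N) : (frame T N).det ^ 2 * A.det = - H.det := by
  rw [← det_lorentzBlock, ← h.frame_mul, Matrix.det_mul, Matrix.det_mul, Matrix.det_transpose]
  ring

theorem det_frame_ne (h : IsAdapted A H T N) : (frame T N).det ≠ 0 := by
  intro h0
  have := h.det_frame_sq
  rw [h0] at this
  exact h.det_ne (by linarith)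

theorem det_metric_ne (h : IsAdapted A H T N) : A.det ≠ 0 := by
  intro h0
  have := h.det_frame_sq
  rw [h0] at this
  exact h.det_ne (by linarith)

/-- The inverse metric is `γ^{kl} T_k T_l - N N`. -/
theorem inv_apply (h : IsAdapted A H T N) (a b : Fin 4) :
    A⁻¹ a b = ∑ k, ∑ l, H⁻¹ k l * T k a * T l b - N a * N b := by
  have hF := h.det_frame_ne.isUnit
  have hmul : A * ((frame T N).transpose * lorentzBlock H⁻¹ * frame T N) = 1 := by
    have hB := lorentzBlock_mul H H⁻¹ (Matrix.mul_nonsing_inv H h.det_ne.isUnit)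
    have : frame T N * (A * ((frame T N).transpose * lorentzBlock H⁻¹ * frame T N))
        = frame T N * 1 := by
      calc _ = (frame T N * A * (frame T N).transpose) * lorentzBlock H⁻¹ * frame T N := by
            simp only [Matrix.mul_assoc]
        _ = _ := by rw [h.frame_mul, hB, Matrix.one_mul, Matrix.mul_one]
    calc _ = (frame T N)⁻¹ * (frame T N * (A * ((frame T N).transpose * lorentzBlock H⁻¹
          * frame T N))) := (Matrix.nonsing_inv_mul_cancel_left _ _ hF).symm
      _ = 1 := by rw [this, Matrix.nonsing_inv_mul_cancel_left _ _ hF]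
  rw [Matrix.inv_eq_right_inv hmul]
  simp [Matrix.mul_apply, frame, lorentzBlock, Fin.sum_univ_four, Fin.sum_univ_three]
  ring

/-- A vector orthogonal to the whole frame vanishes. -/
theorem eq_of_bil_eq (h : IsAdapted A H T N) {u v : Fin 4 → ℝ}
    (hT : ∀ l, bil A u (T l) = bil A v (T l)) (hN : bil A u N = bil A v N) : u = v := by
  have hb (w w' : Fin 4 → ℝ) : bil A w w' = w' ⬝ᵥ A.mulVec w := by
    rw [bil_comm h.symm, bil_eq_dotProduct]
  have hz : (frame T N * A).mulVec (u - v) = 0 := by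
    rw [← Matrix.mulVec_mulVec, Matrix.mulVec_sub, Matrix.mulVec_sub, sub_eq_zero]
    simp only [hb] at hT hN
    ext a
    fin_cases a
    · exact hT 0
    · exact hT 1
    · exact hT 2
    · exact hN
  have := Matrix.eq_zero_of_mulVec_eq_zero (M := frame T N * A)
    (by rw [Matrix.det_mul]; exact mul_ne_zero h.det_frame_ne h.det_metric_ne) hz
  exact sub_eq_zero.1 this

end IsAdapted

end Frame

/-! ### The Gauss and Codazzi equations -/

/-- A spatial hypersurface of the metric `G` in local coordinates: the parametrisation `Y`, its unit
normal `N`, the induced metric `H`, and the second fundamental form `K`, with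
`Kᵢⱼ = g(∇ᵢ∂ⱼY, N)`. -/
structure IsHypersurface (G : EuclideanSpace ℝ (Fin 4) → Matrix (Fin 4) (Fin 4) ℝ)
    (U : Set (EuclideanSpace ℝ (Fin 4)))
    (Y : EuclideanSpace ℝ (Fin 3) → EuclideanSpace ℝ (Fin 4)) (V : Set (EuclideanSpace ℝ (Fin 3)))
    (N : EuclideanSpace ℝ (Fin 3) → Fin 4 → ℝ)
    (H K : EuclideanSpace ℝ (Fin 3) → Matrix (Fin 3) (Fin 3) ℝ) : Prop where
  metric : IsMetricOn G U
  map : IsSmoothMapOn Y V U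
  smooth_normal (μ : Fin 4) : ContDiffOn ℝ ∞ (fun z => N z μ) V
  induced : IsMetricOn H V
  gram (x) (hx : x ∈ V) (i j : Fin 3) : bil (G (Y x)) (tangent Y x i) (tangent Y x j) = H x i j
  orth (x) (hx : x ∈ V) (i : Fin 3) : bil (G (Y x)) (N x) (tangent Y x i) = 0
  unit (x) (hx : x ∈ V) : bil (G (Y x)) (N x) (N x) = -1
  second (x) (hx : x ∈ V) (i j : Fin 3) :
    K x i j = bil (G (Y x)) (covAlong G Y i (fun z => tangent Y z j) x) (N x)

namespace IsHypersurface

variable {G : EuclideanSpace ℝ (Fin 4) → Matrix (Fin 4) (Fin 4) ℝ}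
    {U : Set (EuclideanSpace ℝ (Fin 4))}
    {Y : EuclideanSpace ℝ (Fin 3) → EuclideanSpace ℝ (Fin 4)} {V : Set (EuclideanSpace ℝ (Fin 3))}
    {N : EuclideanSpace ℝ (Fin 3) → Fin 4 → ℝ}
    {H K : EuclideanSpace ℝ (Fin 3) → Matrix (Fin 3) (Fin 3) ℝ} {x : EuclideanSpace ℝ (Fin 3)}

theorem isAdapted (h : IsHypersurface G U Y V N H K) (hx : x ∈ V) :
    IsAdapted (G (Y x)) (H x) (tangent Y x) (N x) where
  symm := h.metric.symm _ (h.map.mapsTo hx)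
  gram := h.gram x hx
  orth := h.orth x hx
  unit := h.unit x hx
  det_ne := h.induced.det_ne x hx

theorem bil_comm (h : IsHypersurface G U Y V N H K) (hx : x ∈ V) (u v : Fin 4 → ℝ) :
    bil (G (Y x)) u v = bil (G (Y x)) v u :=
  Coord.bil_comm (h.isAdapted hx).symm u v

theorem second_symm (h : IsHypersurface G U Y V N H K) (hx : x ∈ V) (i j : Fin 3) :
    K x i j = K x j i := by
  rw [h.second x hx, h.second x hx,
    funext fun μ => h.metric.covAlong_tangent_comm h.map hx i j μ]

/-- The tangential part of `∇ᵢ∂ⱼY` is given by the Christoffel symbols of the induced metric. -/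
theorem bil_covAlong_tangent (h : IsHypersurface G U Y V N H K) (hx : x ∈ V) (l i j : Fin 3) :
    bil (G (Y x)) (covAlong G Y i (fun z => tangent Y z j) x) (tangent Y x l)
      = christoffelLow H x l i j := by
  have hpd (k i j : Fin 3) : pd k (fun z => H z i j) x
      = bil (G (Y x)) (covAlong G Y k (fun z => tangent Y z i) x) (tangent Y x j)
        + bil (G (Y x)) (covAlong G Y k (fun z => tangent Y z j) x) (tangent Y x i) := by
    rw [← pd_congr h.map.isOpen (fun z hz => h.gram z hz i j) hx k,
      h.metric.pd_bil h.map hx (h.map.contDiffOn_tangent i) (h.map.contDiffOn_tangent j),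
      h.bil_comm hx (tangent Y x i)]
  have hs (i j : Fin 3) := funext fun μ => h.metric.covAlong_tangent_comm h.map hx i j μ
  simp only [christoffelLow, hpd]
  rw [hs l i, hs l j, hs j i]
  ring

/-- The Gauss formula `∇ᵢ∂ⱼY = Γᵏᵢⱼ ∂ₖY - Kᵢⱼ N`. -/
theorem covAlong_tangent (h : IsHypersurface G U Y V N H K) (hx : x ∈ V) (i j : Fin 3) :
    covAlong G Y i (fun z => tangent Y z j) x
      = ∑ k, christoffel H x k i j • tangent Y x k - K x i j • N x := by
  have hA := h.isAdapted hx
  have hexp (w : Fin 4 → ℝ) :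
      bil (G (Y x)) (∑ k, christoffel H x k i j • tangent Y x k - K x i j • N x) w
        = ∑ k, christoffel H x k i j * bil (G (Y x)) (tangent Y x k) w
          - K x i j * bil (G (Y x)) (N x) w := by
    simp [bil_eq_dotProduct, sub_dotProduct, sum_dotProduct]
  refine hA.eq_of_bil_eq (fun l => ?_) ?_
  · rw [h.bil_covAlong_tangent hx, hexp, hA.orth, ← h.induced.sum_metric_mul_christoffel hx]
    simp only [hA.gram, mul_zero, sub_zero]
    refine Finset.sum_congr rfl fun k _ => ?_
    rw [h.induced.symm x hx k l]; ring
  · rw [← h.second x hx, hexp, hA.unit]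
    simp [h.bil_comm hx _ (N x), hA.orth]

theorem bil_covAlong_tangent_left (h : IsHypersurface G U Y V N H K) (hx : x ∈ V) (i j : Fin 3)
    (w : Fin 4 → ℝ) :
    bil (G (Y x)) (covAlong G Y i (fun z => tangent Y z j) x) w
        = ∑ k, christoffel H x k i j * bil (G (Y x)) (tangent Y x k) w
          - K x i j * bil (G (Y x)) (N x) w := by
  rw [h.covAlong_tangent hx]
  simp [bil_eq_dotProduct, sub_dotProduct, sum_dotProduct]

/-- The Gauss equation. -/
theorem gauss (h : IsHypersurface G U Y V N H K) (hx : x ∈ V) (l k i j : Fin 3) :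
    riemannForm G (Y x) (tangent Y x l) (tangent Y x k) (tangent Y x i) (tangent Y x j)
      = riemann H x l k i j + K x l i * K x k j - K x l j * K x k i := by
  -- differentiate `g(∇ⱼ∂ₖY, ∂ₗY) = Γ_{ljk}` in direction `i`
  have key (i j : Fin 3) : bil (G (Y x))
      (covAlong G Y i (covAlong G Y j (fun z => tangent Y z k)) x) (tangent Y x l)
      = pd i (fun z => christoffelLow H z l j k) x
        - ∑ c, christoffelLow H x c i l * christoffel H x c j k + K x j k * K x i l := by
    have hsm := h.metric.contDiffOn_covAlong h.map j (h.map.contDiffOn_tangent k)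
    have h1 := h.metric.pd_bil h.map hx hsm (h.map.contDiffOn_tangent l) i
    rw [pd_congr h.map.isOpen (fun z hz => h.bil_covAlong_tangent hz l j k) hx i,
      h.bil_covAlong_tangent_left hx, h.bil_comm hx (N x), ← h.second x hx] at h1
    simp only [h.bil_comm hx (tangent Y x _), h.bil_covAlong_tangent hx] at h1
    rw [h1]
    simp only [mul_comm (christoffelLow H x _ i l)]
    ring
  have hR := h.metric.riemannForm_eq h.map hx (h.map.contDiffOn_tangent k) (tangent Y x l) i j
  rw [hR, key, key, h.induced.riemann_eq hx, h.second_symm hx l i, h.second_symm hx k j,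
    h.second_symm hx l j, h.second_symm hx k i, Finset.sum_sub_distrib]
  ring

/-- The Codazzi equation. -/
theorem codazzi (h : IsHypersurface G U Y V N H K) (hx : x ∈ V) (k i j : Fin 3) :
    riemannForm G (Y x) (N x) (tangent Y x k) (tangent Y x i) (tangent Y x j)
      = covDeriv H K x i j k - covDeriv H K x j i k := by
  have hTN (i c : Fin 3) : bil (G (Y x)) (tangent Y x c) (covAlong G Y i N x) = - K x i c := by
    have h1 := h.metric.pd_bil h.map hx h.smooth_normal (h.map.contDiffOn_tangent c) i
    rw [pd_congr h.map.isOpen (fun z hz => h.orth z hz c) hx i, pd_const,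
      h.bil_comm hx (N x), ← h.second x hx, h.bil_comm hx] at h1
    linarith
  have hNN (i : Fin 3) : bil (G (Y x)) (N x) (covAlong G Y i N x) = 0 := by
    have h1 := h.metric.pd_bil h.map hx h.smooth_normal h.smooth_normal i
    rw [pd_congr h.map.isOpen (fun z hz => h.unit z hz) hx i, pd_const, h.bil_comm hx] at h1
    linarith
  -- differentiate `g(∇ⱼ∂ₖY, N) = Kⱼₖ` in direction `i`
  have key (i j : Fin 3) : bil (G (Y x))
      (covAlong G Y i (covAlong G Y j (fun z => tangent Y z k)) x) (N x)
      = pd i (fun z => K z j k) x + ∑ c, christoffel H x c j k * K x i c := by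
    have hsm := h.metric.contDiffOn_covAlong h.map j (h.map.contDiffOn_tangent k)
    have h1 := h.metric.pd_bil h.map hx hsm h.smooth_normal i
    rw [pd_congr h.map.isOpen (fun z hz => (h.second z hz j k).symm) hx i,
      h.bil_covAlong_tangent_left hx, hNN] at h1
    simp only [hTN] at h1
    rw [h1]
    simp
  rw [h.metric.riemannForm_eq h.map hx (h.map.contDiffOn_tangent k) (N x) i j, key, key]
  simp only [covDeriv, Finset.sum_add_distrib, h.induced.christoffel_symm hx _ j i]
  ring

end IsHypersurface

/-! ### The permutation symbol -/

theorem sum_fun_fin_four {R : Type*} [AddCommMonoid R] {ι : Type*} [Fintype ι]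
    (φ : (Fin 4 → ι) → R) : ∑ a, φ a = ∑ p, ∑ q, ∑ r, ∑ s, φ ![p, q, r, s] := by
  have h (n : ℕ) (ψ : (Fin (n + 1) → ι) → R) :
      ∑ a, ψ a = ∑ p, ∑ b : Fin n → ι, ψ (Matrix.vecCons p b) := by
    rw [← (Fin.consEquiv fun _ : Fin (n + 1) => ι).sum_comp, Fintype.sum_prod_type]
    rfl
  simp only [h, Fintype.sum_unique, Subsingleton.elim (default : Fin 0 → ι) ![]]

theorem det_eq_sum_permSymbol {d : ℕ} (M : Matrix (Fin d) (Fin d) ℝ) :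
    M.det = ∑ c : Fin d → Fin d, permSymbol c * ∏ k, M k (c k) := by
  have hM : (fun k => ∑ l, M k l • (Pi.single l 1 : Fin d → ℝ)) = M := by
    ext k l
    simp [Finset.sum_apply, Pi.single_apply]
  have h := (Matrix.detRowAlternating (n := Fin d) (R := ℝ)).toMultilinearMap.map_sum
    (fun k l => M k l • (Pi.single l 1 : Fin d → ℝ))
  rw [hM] at h
  refine h.trans (Finset.sum_congr rfl fun c _ => ?_)
  rw [MultilinearMap.map_smul_univ, smul_eq_mul, mul_comm]
  congr 1
  refine congrArg Matrix.det ?_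
  ext k l
  simp [Pi.single_apply, eq_comm]

/-- Change of frame for the permutation symbol. -/
theorem det_mul_permSymbol {d : ℕ} (F : Matrix (Fin d) (Fin d) ℝ) (a : Fin d → Fin d) :
    F.det * permSymbol a = ∑ c : Fin d → Fin d, permSymbol c * ∏ k, F (c k) (a k) := by
  have h := det_eq_sum_permSymbol (Matrix.of fun k l => F l (a k))
  simp only [Matrix.of_apply] at h
  rw [← h, permSymbol, mul_comm, ← Matrix.det_transpose F, ← Matrix.det_mul]
  congr 1
  ext k l
  simp [Matrix.mul_apply]


theorem permSymbol_eq_zero {d : ℕ} {a : Fin d → Fin d} {k l : Fin d} (hkl : k ≠ l)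
    (h : a k = a l) : permSymbol a = 0 :=
  Matrix.det_zero_of_row_eq hkl (by ext; simp [h])

theorem permSymbol_swap (a b c : Fin 3) :
    permSymbol ![a, b, c] = - permSymbol ![b, a, c] := by
  fin_cases a <;> fin_cases b <;> fin_cases c <;> simp [permSymbol, Matrix.det_fin_three]

theorem permSymbol_rotate (a b c : Fin 3) : permSymbol ![a, b, c] = permSymbol ![b, c, a] := by
  fin_cases a <;> fin_cases b <;> fin_cases c <;> simp [permSymbol, Matrix.det_fin_three]

/-- With the last index in the third slot, the four-dimensional permutation symbol is minus the
three-dimensional one: one transposition moves that index to the end. -/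
theorem permSymbol_four (a b c : Fin 3) :
    permSymbol ![a.castSucc, b.castSucc, 3, c.castSucc] = - permSymbol ![a, b, c] := by
  have hs (i : Fin 3) : Fin.castSucc i ≠ (3 : Fin 4) := (Fin.castSucc_lt_last i).ne
  simp only [permSymbol]
  rw [Matrix.det_succ_column _ 3, Fin.sum_univ_four]
  have hsub : ((Matrix.of fun k l => if ![a.castSucc, b.castSucc, 3, c.castSucc] k = l
      then (1 : ℝ) else 0).submatrix (Fin.succAbove 2) (Fin.succAbove 3)).det
      = (Matrix.of fun k l => if ![a, b, c] k = l then (1 : ℝ) else 0).det := by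
    congr 1
    ext k l
    have hl : Fin.succAbove 3 l = l.castSucc := Fin.succAbove_last_apply l
    simp only [Matrix.submatrix_apply, Matrix.of_apply, hl]
    fin_cases k <;> simp [Fin.succAbove] <;> congr
  simp [hs, hsub]
  norm_num

theorem sum_rotate {R ι κ : Type*} [AddCommMonoid R] [Fintype ι] [Fintype κ]
    (f : ι → ι → ι → ι → κ → R) :
    ∑ a, ∑ b, ∑ c, ∑ d, ∑ p, f a b c d p = ∑ p, ∑ a, ∑ b, ∑ c, ∑ d, f a b c d p := by
  symm
  rw [Finset.sum_comm]
  refine Finset.sum_congr rfl fun a _ => ?_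
  rw [Finset.sum_comm]
  refine Finset.sum_congr rfl fun b _ => ?_
  rw [Finset.sum_comm]
  refine Finset.sum_congr rfl fun c _ => ?_
  rw [Finset.sum_comm]

/-- The components in a frame of the contraction of `ε` with a bilinear form and two covectors. -/
theorem det_mul_sum_permSymbol (F X : Matrix (Fin 4) (Fin 4) ℝ) (n t : Fin 4 → ℝ) :
    F.det * ∑ p, ∑ q, X p q * ∑ r, ∑ s, permSymbol ![p, q, r, s] * n r * t s
      = ∑ p, ∑ q, bil X (F p) (F q) *
        ∑ r, ∑ s, permSymbol ![p, q, r, s] * (n ⬝ᵥ F r) * (t ⬝ᵥ F s) := by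
  have h1 : ∑ p, ∑ q, X p q * ∑ r, ∑ s, permSymbol ![p, q, r, s] * n r * t s
      = ∑ a : Fin 4 → Fin 4, permSymbol a * (X (a 0) (a 1) * n (a 2) * t (a 3)) := by
    rw [sum_fun_fin_four]
    simp only [Finset.mul_sum]
    refine Finset.sum_congr rfl fun p _ => Finset.sum_congr rfl fun q _ =>
      Finset.sum_congr rfl fun r _ => Finset.sum_congr rfl fun s _ => ?_
    simp
    ring
  rw [h1, Finset.mul_sum]
  simp only [← mul_assoc, det_mul_permSymbol, Finset.sum_mul]
  rw [Finset.sum_comm, sum_fun_fin_four]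
  simp only [Finset.mul_sum]
  refine Finset.sum_congr rfl fun A _ => Finset.sum_congr rfl fun B _ =>
      Finset.sum_congr rfl fun C _ => Finset.sum_congr rfl fun D _ => ?_
  rw [sum_fun_fin_four]
  have h2 : bil X (F A) (F B) * (permSymbol ![A, B, C, D] * (n ⬝ᵥ F C) * (t ⬝ᵥ F D))
      = ∑ p, ∑ q, X p q * F A p * F B q * ∑ r, n r * F C r *
        ∑ s, permSymbol ![A, B, C, D] * (t s * F D s) := by
    simp only [bil, dotProduct, ← Finset.mul_sum, ← Finset.sum_mul]
    ring
  rw [h2]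
  simp only [Finset.mul_sum]
  refine Finset.sum_congr rfl fun p _ => Finset.sum_congr rfl fun q _ =>
      Finset.sum_congr rfl fun r _ => Finset.sum_congr rfl fun s _ => ?_
  simp [Fin.prod_univ_four]
  ring

/-- Contracting the four-dimensional `ε` with the unit normal gives the three-dimensional `ε`,
provided that the frame is positively oriented. -/
theorem IsAdapted.sum_eps {A : Matrix (Fin 4) (Fin 4) ℝ} {H : Matrix (Fin 3) (Fin 3) ℝ}
    {T : Fin 3 → Fin 4 → ℝ} {N : Fin 4 → ℝ} (h : IsAdapted A H T N) (hH : 0 < H.det)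
    (hF : 0 < (frame T N).det) (X : Matrix (Fin 4) (Fin 4) ℝ) (j : Fin 3) :
    ∑ p, ∑ q, X p q * ∑ r, ∑ s, permSymbol ![p, q, r, s] / √|A.det| * A.mulVec N r
        * A.mulVec (T j) s
      = ∑ k, ∑ l, bil X (T k) (T l) * ∑ m, permSymbol ![k, l, m] / √|H.det| * H m j := by
  have hsq : (frame T N).det * √|A.det| = √|H.det| := by
    have h1 : |H.det| = (frame T N).det ^ 2 * |A.det| := by
      rw [← abs_neg H.det, ← h.det_frame_sq, abs_mul, abs_of_nonneg (sq_nonneg _)]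
    rw [h1, Real.sqrt_mul (sq_nonneg _), Real.sqrt_sq hF.le]
  have hH0 : √|H.det| ≠ 0 := (Real.sqrt_pos.2 (abs_pos.2 hH.ne')).ne'
  have hA0 : √|A.det| ≠ 0 := (Real.sqrt_pos.2 (abs_pos.2 h.det_metric_ne)).ne'
  have hdot (u v : Fin 4 → ℝ) : A.mulVec u ⬝ᵥ v = bil A v u := by
    rw [bil_eq_dotProduct, dotProduct_comm]
  have hs (i : Fin 3) : frame T N i.castSucc = T i := by fin_cases i <;> rfl
  have h3 : frame T N (Fin.last 3) = N := rfl
  have hTN (i : Fin 3) : bil A (T i) N = 0 := by rw [bil_comm h.symm, h.orth]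
  have key := det_mul_sum_permSymbol (frame T N) X (A.mulVec N) (A.mulVec (T j))
  simp only [hdot] at key
  have key2 : ∑ p, ∑ q, bil X (frame T N p) (frame T N q) *
        ∑ r, ∑ s, permSymbol ![p, q, r, s] * bil A (frame T N r) N * bil A (frame T N s) (T j)
      = ∑ k, ∑ l, bil X (T k) (T l) * ∑ m, permSymbol ![k, l, m] * H m j := by
    have hz1 (q s : Fin 4) : permSymbol ![Fin.last 3, q, Fin.last 3, s] = 0 :=
      permSymbol_eq_zero (k := 0) (l := 2) (by decide) rfl
    have hz2 (q s : Fin 4) : permSymbol ![q, Fin.last 3, Fin.last 3, s] = 0 :=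
      permSymbol_eq_zero (k := 1) (l := 2) (by decide) rfl
    have h4 (a b c : Fin 3) : permSymbol ![a.castSucc, b.castSucc, Fin.last 3, c.castSucc]
      = - permSymbol ![a, b, c] := permSymbol_four a b c
    simp only [Fin.sum_univ_castSucc (n := 3), hs, h3, hTN, h.unit, h.orth, h.gram, hz1, hz2, h4]
    simp
  rw [key2] at key
  have hl : ∑ p, ∑ q, X p q * ∑ r, ∑ s, permSymbol ![p, q, r, s] / √|A.det| * A.mulVec N r
        * A.mulVec (T j) s
      = (∑ p, ∑ q, X p q * ∑ r, ∑ s, permSymbol ![p, q, r, s] * A.mulVec N r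
        * A.mulVec (T j) s) / √|A.det| := by
    simp only [Finset.mul_sum, Finset.sum_div]
    refine Finset.sum_congr rfl fun p _ => Finset.sum_congr rfl fun q _ =>
      Finset.sum_congr rfl fun r _ => Finset.sum_congr rfl fun s _ => ?_
    ring
  have hr : ∑ k, ∑ l, bil X (T k) (T l) * ∑ m, permSymbol ![k, l, m] / √|H.det| * H m j
      = (∑ k, ∑ l, bil X (T k) (T l) * ∑ m, permSymbol ![k, l, m] * H m j) / √|H.det| := by
    simp only [Finset.mul_sum, Finset.sum_div]
    refine Finset.sum_congr rfl fun p _ => Finset.sum_congr rfl fun q _ =>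
      Finset.sum_congr rfl fun r _ => ?_
    ring
  rw [hl, hr, ← key, ← hsq]
  field_simp

/-- A tensor `C_{ikl}`, antisymmetric in `k, l` and with vanishing trace `γ^{lk} C_{lkz}`, has a
symmetric dual `C_{ikl} ε^{kl}_j`. -/
theorem dual_symm {H : Matrix (Fin 3) (Fin 3) ℝ} (hH : ∀ i j, H i j = H j i) (hdet : H.det ≠ 0)
    (C : Fin 3 → Fin 3 → Fin 3 → ℝ) (hC : ∀ i k l, C i k l = - C i l k)
    (htr : ∀ z, ∑ k, ∑ l, H⁻¹ k l * C l k z = 0) (i j : Fin 3) :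
    ∑ k, ∑ l, C i k l * ∑ m, permSymbol ![k, l, m] * H m j
      = ∑ k, ∑ l, C j k l * ∑ m, permSymbol ![k, l, m] * H m i := by
  -- the rows of `a` are half the duals of the antisymmetric matrices `C i`
  set a : Matrix (Fin 3) (Fin 3) ℝ := Matrix.of fun i => ![C i 1 2, C i 2 0, C i 0 1] with ha
  have hCii (i k : Fin 3) : C i k k = 0 := by have := hC i k k; linarith
  have hP : (H⁻¹ * a).IsSymm := by
    have h0 := htr 0
    have h1 := htr 1
    have h2 := htr 2
    simp only [Fin.sum_univ_three, hCii, hC _ 1 0, hC _ 2 1, hC _ 0 2] at h0 h1 h2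
    ext p q
    fin_cases p <;> fin_cases q <;>
      simp [Matrix.mul_apply, Fin.sum_univ_three, ha] <;> linarith
  have hHs : H.IsSymm := by ext p q; exact hH q p
  have haH : (a * H).IsSymm := by
    have : a * H = H * (H⁻¹ * a) * H := by
      rw [Matrix.mul_nonsing_inv_cancel_left _ _ hdet.isUnit]
    rw [this, Matrix.IsSymm, Matrix.transpose_mul, Matrix.transpose_mul, hP.eq, hHs.eq]
    simp only [Matrix.mul_assoc]
  have hval (i j : Fin 3) : ∑ k, ∑ l, C i k l * ∑ m, permSymbol ![k, l, m] * H m j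
      = 2 * (a * H) i j := by
    simp [Matrix.mul_apply, Fin.sum_univ_three, ha, permSymbol, Matrix.det_fin_three, hCii,
      hC _ 1 0, hC _ 2 1, hC _ 0 2]
    ring
  rw [hval, hval, haH.apply]

/-! ### The electric and magnetic parts of the Weyl tensor of a vacuum metric -/

section RiemannForm

variable {G : EuclideanSpace ℝ (Fin 4) → Matrix (Fin 4) (Fin 4) ℝ}
  {U : Set (EuclideanSpace ℝ (Fin 4))} {y : EuclideanSpace ℝ (Fin 4)}

theorem IsMetricOn.riemannForm_antisymm (hG : IsMetricOn G U) (hy : y ∈ U) (u v w z : Fin 4 → ℝ) :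
    riemannForm G y u v w z = - riemannForm G y v u w z := by
  simp only [riemannForm, ← Finset.sum_neg_distrib]
  rw [Finset.sum_comm]
  refine Finset.sum_congr rfl fun a _ => Finset.sum_congr rfl fun b _ =>
    Finset.sum_congr rfl fun m _ => Finset.sum_congr rfl fun n _ => ?_
  rw [hG.riemann_antisymm hy b a]; ring

theorem riemannForm_antisymm_right (u v w z : Fin 4 → ℝ) :
    riemannForm G y u v w z = - riemannForm G y u v z w := by
  simp only [riemannForm, ← Finset.sum_neg_distrib]
  refine Finset.sum_congr rfl fun a _ => Finset.sum_congr rfl fun b _ => ?_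
  rw [Finset.sum_comm]
  refine Finset.sum_congr rfl fun m _ => Finset.sum_congr rfl fun n _ => ?_
  rw [riemann_antisymm_right G y a b n m]; ring

/-- In vacuum the Ricci tensor vanishes. -/
theorem IsMetricOn.ricci_eq_zero (hG : IsMetricOn G U) (hy : y ∈ U)
    (hvac : ∀ a b, ricci G y a b - (1 / 2) * scalarCurvature G y * G y a b = 0) (a b : Fin 4) :
    ricci G y a b = 0 := by
  have hR (a b : Fin 4) : ricci G y a b = (1 / 2) * scalarCurvature G y * G y a b := by
    linarith [hvac a b]
  have htr : ∑ a, ∑ b, (G y)⁻¹ a b * G y a b = 4 := by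
    have : ∀ a, ∑ b, (G y)⁻¹ a b * G y a b = 1 := fun a => by
      have h := hG.sum_inv_mul hy a a
      rw [if_pos rfl] at h
      rw [← h]
      exact Finset.sum_congr rfl fun b _ => by rw [hG.symm y hy a b]
    simp [this]
  have hs : scalarCurvature G y = (1 / 2) * scalarCurvature G y * 4 := by
    rw [← htr]
    conv_lhs => rw [scalarCurvature]
    simp only [hR, Finset.mul_sum]
    refine Finset.sum_congr rfl fun a _ => Finset.sum_congr rfl fun b _ => ?_
    ring
  have : scalarCurvature G y = 0 := by linarith
  rw [hR, this]; ring

theorem weyl_eq_riemann (hric : ∀ a b, ricci G y a b = 0) (a b m n : Fin 4) :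
    weyl G y a b m n = riemann G y a b m n := by
  simp [weyl, scalarCurvature, hric]

/-- The trace of the Riemann tensor in an adapted frame. -/
theorem IsMetricOn.sum_riemannForm (hG : IsMetricOn G U) (hy : y ∈ U)
    (hric : ∀ a b, ricci G y a b = 0) {H : Matrix (Fin 3) (Fin 3) ℝ} {T : Fin 3 → Fin 4 → ℝ}
    {N : Fin 4 → ℝ} (hA : IsAdapted (G y) H T N) (v w : Fin 4 → ℝ) :
    ∑ k, ∑ l, H⁻¹ k l * riemannForm G y (T l) v (T k) w = riemannForm G y N v N w := by
  have h1 : ∑ k, ∑ l, H⁻¹ k l * riemannForm G y (T l) v (T k) w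
      = ∑ c, ∑ b, ∑ a, ∑ n, riemann G y c b a n * (∑ k, ∑ l, H⁻¹ k l * T k a * T l c)
        * v b * w n := by
    simp only [Finset.mul_sum, Finset.sum_mul]
    rw [sum_rotate]
    refine Finset.sum_congr rfl fun k _ => ?_
    rw [sum_rotate]
    refine Finset.sum_congr rfl fun l _ => ?_
    simp only [riemannForm, Finset.mul_sum]
    refine Finset.sum_congr rfl fun a _ => Finset.sum_congr rfl fun b _ =>
      Finset.sum_congr rfl fun m _ => Finset.sum_congr rfl fun n _ => ?_
    ring
  have h2 : ∑ c, ∑ b, ∑ a, ∑ n, riemann G y c b a n * (G y)⁻¹ a c * v b * w n = 0 := by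
    rw [Finset.sum_comm]
    refine Finset.sum_eq_zero fun b _ => ?_
    rw [Finset.sum_congr rfl fun c _ => Finset.sum_comm, Finset.sum_comm]
    refine Finset.sum_eq_zero fun n _ => ?_
    have h := hric b n
    simp only [ricci, hG.riemannUp_eq hy] at h
    rw [Finset.sum_comm]
    calc _ = (∑ a, ∑ c, (G y)⁻¹ a c * riemann G y c b a n) * (v b * w n) := by
          simp only [Finset.sum_mul]
          refine Finset.sum_congr rfl fun a _ => Finset.sum_congr rfl fun c _ => ?_
          ring
      _ = 0 := by rw [h, zero_mul]
  simp only [hA.inv_apply, mul_sub, sub_mul, Finset.sum_sub_distrib] at h2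
  rw [h1, sub_eq_zero.1 h2, riemannForm]
  refine Finset.sum_congr rfl fun a _ => Finset.sum_congr rfl fun b _ =>
    Finset.sum_congr rfl fun m _ => Finset.sum_congr rfl fun n _ => ?_
  ring

/-- The electric part contracted with two vectors. -/
theorem sum_electric (hric : ∀ a b, ricci G y a b = 0) (s t u : Fin 4 → ℝ) :
    ∑ α, ∑ β, s α * t β * electric G y u α β = riemannForm G y s u u t := by
  simp only [electric, weyl_eq_riemann hric, riemannForm, Finset.mul_sum]
  refine Finset.sum_congr rfl fun a _ => ?_
  rw [Finset.sum_comm]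
  refine Finset.sum_congr rfl fun b _ => ?_
  rw [Finset.sum_comm]
  refine Finset.sum_congr rfl fun m _ => Finset.sum_congr rfl fun n _ => ?_
  ring

/-- The magnetic part contracted with two vectors. -/
theorem sum_magnetic (hric : ∀ a b, ricci G y a b = 0) (s t u : Fin 4 → ℝ) :
    ∑ α, ∑ β, s α * t β * magnetic G y u α β
      = (1 / 2) * ∑ p, ∑ q, (∑ a, ∑ b, riemann G y a b p q * s a * u b)
        * ∑ r, ∑ q', permSymbol ![p, q, r, q'] / √|(G y).det| * (G y).mulVec u r
          * (G y).mulVec t q' := by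
  have hD (p q : Fin 4) : ∑ r, ∑ q', permSymbol ![p, q, r, q'] / √|(G y).det| * (G y).mulVec u r
          * (G y).mulVec t q'
      = ∑ β, ∑ n, (∑ r, ∑ q', epsUp G y ![p, q, r, q'] * G y r n * G y q' β) * (u n * t β) := by
    simp only [Matrix.mulVec, dotProduct, epsUp, Finset.mul_sum, Finset.sum_mul]
    symm
    rw [Finset.sum_congr rfl fun β _ => Finset.sum_comm, Finset.sum_comm]
    refine Finset.sum_congr rfl fun r _ => ?_
    rw [Finset.sum_congr rfl fun β _ => Finset.sum_comm, Finset.sum_comm]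
    refine Finset.sum_congr rfl fun q' _ => Finset.sum_congr rfl fun β _ =>
      Finset.sum_congr rfl fun n _ => ?_
    ring
  have hL : ∑ α, ∑ β, s α * t β * magnetic G y u α β
      = ∑ α, ∑ β, ∑ m, ∑ n, ∑ p, ∑ q, (1 / 2) * (riemann G y α m p q * s α * u m
        * ((∑ r, ∑ q', epsUp G y ![p, q, r, q'] * G y r n * G y q' β) * (u n * t β))) := by
    obtain ⟨E, hE⟩ : ∃ E : Fin 4 → Fin 4 → Fin 4 → Fin 4 → ℝ, ∀ p q n β,
        ∑ r, ∑ q', epsUp G y ![p, q, r, q'] * G y r n * G y q' β = E p q n β :=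
      ⟨_, fun _ _ _ _ => rfl⟩
    simp only [magnetic, weylDual, weyl_eq_riemann hric, hE, Finset.mul_sum, Finset.sum_mul]
    refine Finset.sum_congr rfl fun α _ => Finset.sum_congr rfl fun β _ =>
      Finset.sum_congr rfl fun m _ => Finset.sum_congr rfl fun n _ =>
      Finset.sum_congr rfl fun p _ => Finset.sum_congr rfl fun q _ => ?_
    ring
  rw [hL, sum_rotate, Finset.mul_sum]
  refine Finset.sum_congr rfl fun p _ => ?_
  rw [sum_rotate, Finset.mul_sum]
  refine Finset.sum_congr rfl fun q _ => ?_
  rw [hD]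
  simp only [← Finset.mul_sum]
  congr 1
  rw [Finset.sum_mul]
  refine Finset.sum_congr rfl fun α _ => ?_
  rw [Finset.sum_comm, Finset.sum_mul]
  refine Finset.sum_congr rfl fun m _ => ?_
  simp only [← Finset.mul_sum]

end RiemannForm

namespace IsHypersurface

variable {G : EuclideanSpace ℝ (Fin 4) → Matrix (Fin 4) (Fin 4) ℝ}
    {U : Set (EuclideanSpace ℝ (Fin 4))}
    {Y : EuclideanSpace ℝ (Fin 3) → EuclideanSpace ℝ (Fin 4)} {V : Set (EuclideanSpace ℝ (Fin 3))}
    {N : EuclideanSpace ℝ (Fin 3) → Fin 4 → ℝ}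
    {H K : EuclideanSpace ℝ (Fin 3) → Matrix (Fin 3) (Fin 3) ℝ} {x : EuclideanSpace ℝ (Fin 3)}

/-- The electric part, by the trace of the Gauss equation. -/
theorem electric_eq (h : IsHypersurface G U Y V N H K) (hx : x ∈ V)
    (hric : ∀ a b, ricci G (Y x) a b = 0) (i j : Fin 3) :
    ∑ α, ∑ β, tangent Y x i α * tangent Y x j β * electric G (Y x) (N x) α β
      = - ricci H x i j - (∑ k, ∑ l, (H x)⁻¹ k l * K x k l) * K x i j
        + ∑ k, ∑ l, K x i k * (H x)⁻¹ k l * K x l j := by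
  have hy := h.map.mapsTo hx
  rw [sum_electric hric, h.metric.riemannForm_antisymm hy,
    ← h.metric.sum_riemannForm hy hric (h.isAdapted hx)]
  simp only [h.gauss hx, ricci, h.induced.riemannUp_eq hx, Finset.sum_mul, mul_add, mul_sub,
    Finset.sum_add_distrib, Finset.sum_sub_distrib]
  have h1 : ∑ k, ∑ l, (H x)⁻¹ k l * (K x l k * K x i j)
      = ∑ k, ∑ l, (H x)⁻¹ k l * K x k l * K x i j :=
    Finset.sum_congr rfl fun k _ => Finset.sum_congr rfl fun l _ => by
      rw [h.second_symm hx l k]; ring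
  have h2 : ∑ k, ∑ l, (H x)⁻¹ k l * (K x l j * K x i k)
      = ∑ k, ∑ l, K x i k * (H x)⁻¹ k l * K x l j :=
    Finset.sum_congr rfl fun k _ => Finset.sum_congr rfl fun l _ => by ring
  rw [h1, h2]
  ring

/-- The magnetic part, by the Codazzi equation. The free indices come out in the opposite order,
which does not matter because the dual of the trace-free tensor `R(N, ∂ᵢ, ∂ₖ, ∂ₗ)` is symmetric. -/
theorem magnetic_eq (h : IsHypersurface G U Y V N H K) (hx : x ∈ V)
    (hric : ∀ a b, ricci G (Y x) a b = 0) (hdet : 0 < (H x).det)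
    (hor : 0 < (frame (tangent Y x) (N x)).det) (i j : Fin 3) :
    ∑ α, ∑ β, tangent Y x i α * tangent Y x j β * magnetic G (Y x) (N x) α β
      = ∑ k, ∑ l, (∑ m, H x i m * epsUp H x ![m, k, l]) * covDeriv H K x l k j := by
  have hy := h.map.mapsTo hx
  have hA := h.isAdapted hx
  set C : Fin 3 → Fin 3 → Fin 3 → ℝ := fun i k l =>
    riemannForm G (Y x) (N x) (tangent Y x i) (tangent Y x k) (tangent Y x l) with hCdef
  have hC (i k l : Fin 3) : C i k l = - C i l k := riemannForm_antisymm_right _ _ _ _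
  -- the momentum constraint
  have htr (z : Fin 3) : ∑ k, ∑ l, (H x)⁻¹ k l * C l k z = 0 := by
    have h1 := h.metric.sum_riemannForm hy hric hA (N x) (tangent Y x z)
    have h2 := h.metric.riemannForm_antisymm hy (N x) (N x) (N x) (tangent Y x z)
    have h3 : riemannForm G (Y x) (N x) (N x) (N x) (tangent Y x z) = 0 := by linarith
    rw [h3] at h1
    simp only [h.metric.riemannForm_antisymm hy _ (N x), mul_neg, Finset.sum_neg_distrib] at h1
    exact neg_eq_zero.1 h1
  have hbil (k l : Fin 3) : bil (Matrix.of fun p q =>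
      ∑ a, ∑ b, riemann G (Y x) a b p q * tangent Y x i a * N x b) (tangent Y x k) (tangent Y x l)
      = - C i k l := by
    rw [hCdef, ← h.metric.riemannForm_antisymm hy]
    simp only [bil, Matrix.of_apply, riemannForm, Finset.sum_mul]
    symm
    rw [Finset.sum_congr rfl fun a _ => Finset.sum_comm, Finset.sum_comm]
    refine Finset.sum_congr rfl fun p _ => ?_
    rw [Finset.sum_congr rfl fun a _ => Finset.sum_comm, Finset.sum_comm]
  have hsum := hA.sum_eps hdet hor (Matrix.of fun p q =>
      ∑ a, ∑ b, riemann G (Y x) a b p q * tangent Y x i a * N x b) j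
  simp only [Matrix.of_apply] at hsum
  have hdual := dual_symm (h.induced.symm x hx) hA.det_ne C hC htr i j
  have hCod (k l : Fin 3) : C j k l = covDeriv H K x k l j - covDeriv H K x l k j :=
    h.codazzi hx j k l
  -- antisymmetrising `Dₗ Kₖⱼ` in `k, l`, since `ε` is antisymmetric
  have hR : ∑ k, ∑ l, C j k l * ∑ m, permSymbol ![k, l, m] * H x m i
      = - 2 * ∑ k, ∑ l, (∑ m, permSymbol ![k, l, m] * H x m i) * covDeriv H K x l k j := by
    simp only [hCod, sub_mul, Finset.sum_sub_distrib]
    rw [Finset.sum_comm]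
    have : ∑ l, ∑ k, covDeriv H K x k l j * ∑ m, permSymbol ![k, l, m] * H x m i
        = - ∑ k, ∑ l, covDeriv H K x l k j * ∑ m, permSymbol ![k, l, m] * H x m i := by
      simp only [← Finset.sum_neg_distrib]
      refine Finset.sum_congr rfl fun k _ => Finset.sum_congr rfl fun l _ => ?_
      simp only [permSymbol_swap l k, neg_mul, Finset.sum_neg_distrib, mul_neg]
    rw [this]
    simp only [mul_comm (∑ m, _)]
    ring
  have hfin : ∑ k, ∑ l, (∑ m, H x i m * epsUp H x ![m, k, l]) * covDeriv H K x l k j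
      = (∑ k, ∑ l, (∑ m, permSymbol ![k, l, m] * H x m i) * covDeriv H K x l k j)
        / √|(H x).det| := by
    simp only [epsUp, Finset.sum_div, Finset.sum_mul]
    refine Finset.sum_congr rfl fun k _ => Finset.sum_congr rfl fun l _ =>
      Finset.sum_congr rfl fun m _ => ?_
    rw [h.induced.symm x hx i m, permSymbol_rotate m k l]
    ring
  have hneg : ∑ k, ∑ l, - C i k l * ∑ m, permSymbol ![k, l, m] / √|(H x).det| * H x m j
      = - (∑ k, ∑ l, C i k l * ∑ m, permSymbol ![k, l, m] * H x m j) / √|(H x).det| := by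
    simp only [Finset.sum_div, Finset.mul_sum, ← Finset.sum_neg_distrib]
    refine Finset.sum_congr rfl fun k _ => Finset.sum_congr rfl fun l _ =>
      Finset.sum_congr rfl fun m _ => ?_
    ring
  rw [sum_magnetic hric, hsum]
  simp only [hbil]
  rw [hneg, hdual, hR, hfin]
  ring

end IsHypersurface

end Coord

/-! ### Metrics on manifolds in charts -/

section Charts

variable {E E' F : Type*} [NormedAddCommGroup E] [NormedSpace ℝ E]
  [NormedAddCommGroup E'] [NormedSpace ℝ E'] [NormedAddCommGroup F] [NormedSpace ℝ F]
  {M : Type*} [TopologicalSpace M] [ChartedSpace E M] [IsManifold 𝓘(ℝ, E) ∞ M]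
  {M' : Type*} [TopologicalSpace M'] [ChartedSpace E' M'] [IsManifold 𝓘(ℝ, E') ∞ M']
  {N : Type*} [TopologicalSpace N] [ChartedSpace F N]

/-- The pushforward of a smooth field of tangent vectors by a smooth map is smooth. -/
theorem ContMDiffOn.mfderiv_field {φ : M → M'} {s : Set M} (hs : IsOpen s)
    (hφ : ContMDiffOn 𝓘(ℝ, E) 𝓘(ℝ, E') ∞ φ s) {t : Set N} {b : N → M}
    {X : (z : N) → TangentSpace 𝓘(ℝ, E) (b z)}
    (hX : ContMDiffOn 𝓘(ℝ, F) 𝓘(ℝ, E).tangent ∞ (fun z => (⟨b z, X z⟩ : TangentBundle 𝓘(ℝ, E) M)) t)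
    (hb : Set.MapsTo b t s) :
    ContMDiffOn 𝓘(ℝ, F) 𝓘(ℝ, E').tangent ∞
      (fun z => (⟨φ (b z), mfderiv 𝓘(ℝ, E) 𝓘(ℝ, E') φ (b z) (X z)⟩ : TangentBundle 𝓘(ℝ, E') M'))
      t := by
  have : IsManifold 𝓘(ℝ, E) 1 M := IsManifold.of_le (n := ∞) (by simp)
  have : IsManifold 𝓘(ℝ, E') 1 M' := IsManifold.of_le (n := ∞) (by simp)
  have h := hφ.contMDiffOn_tangentMapWithin (m := ∞) (by simp) hs.uniqueMDiffOn
  refine (h.comp hX fun z hz => hb hz).congr fun z hz => ?_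
  simp only [Function.comp, tangentMapWithin, mfderivWithin_of_isOpen hs (hb hz)]

end Charts

theorem mdifferentiable_of_mem_maximalAtlas {d : ℕ} {M : Type*} [TopologicalSpace M]
    [ChartedSpace (EuclideanSpace ℝ (Fin d)) M] [IsManifold (𝓡 d) ∞ M]
    {e : OpenPartialHomeomorph M (EuclideanSpace ℝ (Fin d))}
    (he : e ∈ IsManifold.maximalAtlas (𝓡 d) ∞ M) : e.MDifferentiable (𝓡 d) (𝓡 d) :=
  ⟨(contMDiffOn_of_mem_maximalAtlas he).mdifferentiableOn (by simp),
    (contMDiffOn_symm_of_mem_maximalAtlas he).mdifferentiableOn (by simp)⟩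

namespace LorentzMetric

variable {M : Type*} [TopologicalSpace M] [ChartedSpace (EuclideanSpace ℝ (Fin 4)) M]
  [IsManifold (𝓡 4) ∞ M] (g : LorentzMetric M)
  {e : OpenPartialHomeomorph M (EuclideanSpace ℝ (Fin 4))}

theorem contDiffOn_components (he : e ∈ IsManifold.maximalAtlas (𝓡 4) ∞ M) (i j : Fin 4) :
    ContDiffOn ℝ ∞ (fun y => g.components e y i j) e.target := by
  have hsymm := contMDiffOn_symm_of_mem_maximalAtlas he
  have hv (i : Fin 4) : ContMDiffOn (𝓡 4) (𝓡 4).tangent ∞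
      (fun y => (⟨e.symm y, mfderiv (𝓡 4) (𝓡 4) e.symm y (EuclideanSpace.single i 1)⟩ :
        TangentBundle (𝓡 4) M)) e.target :=
    hsymm.mfderiv_field e.open_target
      ((contMDiff_vectorSpace_iff_contDiff.2 contDiff_const).contMDiffOn) fun y hy => hy
  rw [← contMDiffOn_iff_contDiffOn]
  intro y hy
  have : ContMDiffWithinAt (𝓡 4) ((𝓡 4).prod 𝓘(ℝ)) ∞
      (fun y => TotalSpace.mk' ℝ (E := Bundle.Trivial M ℝ) (e.symm y)
        (g.form (e.symm y) (mfderiv (𝓡 4) (𝓡 4) e.symm y (EuclideanSpace.single i 1))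
          (mfderiv (𝓡 4) (𝓡 4) e.symm y (EuclideanSpace.single j 1)))) e.target y := by
    apply ContMDiffWithinAt.clm_bundle_apply₂ (F₁ := EuclideanSpace ℝ (Fin 4))
      (F₂ := EuclideanSpace ℝ (Fin 4))
    · exact g.contMDiff.contMDiffAt.comp_contMDiffWithinAt y (hsymm y hy)
    · exact hv i y hy
    · exact hv j y hy
  simp only [contMDiffWithinAt_totalSpace] at this
  exact this.2

/-- The metric on tangent vectors, in terms of their components in a chart. -/
theorem form_eq_bil (he : e ∈ IsManifold.maximalAtlas (𝓡 4) ∞ M) {p : M} (hp : p ∈ e.source)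
    (u v : TangentSpace (𝓡 4) p) :
    g.form p u v = Coord.bil (g.components e (e p))
      (show EuclideanSpace ℝ (Fin 4) from mfderiv (𝓡 4) (𝓡 4) e p u)
      (show EuclideanSpace ℝ (Fin 4) from mfderiv (𝓡 4) (𝓡 4) e p v) := by
  have hpt (q : M) (hq : q = p) (a b : EuclideanSpace ℝ (Fin 4)) :
      g.form q a b = g.form p a b := by subst hq; rfl
  have hd := mdifferentiable_of_mem_maximalAtlas he
  -- tangent spaces are identified with `ℝ⁴`, to have the linear structure of the model at hand
  let L : EuclideanSpace ℝ (Fin 4) →L[ℝ] EuclideanSpace ℝ (Fin 4) :=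
    mfderiv (𝓡 4) (𝓡 4) e.symm (e p)
  have hexp (u : EuclideanSpace ℝ (Fin 4)) :
      u = ∑ i, (show EuclideanSpace ℝ (Fin 4) from mfderiv (𝓡 4) (𝓡 4) e p u) i •
        L (EuclideanSpace.single i 1) := by
    have h1 : L (mfderiv (𝓡 4) (𝓡 4) e p u) = u :=
      congrArg (fun T => T u) (hd.symm_comp_deriv hp)
    conv_lhs => rw [← h1]
    simp only [← map_smul, ← map_sum]
    congr 1
    ext k
    simp [Finset.sum_apply, Pi.single_apply]
  have hG (i j : Fin 4) : g.components e (e p) i j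
      = g.form p (L (EuclideanSpace.single i 1)) (L (EuclideanSpace.single j 1)) :=
    hpt _ (e.left_inv hp) _ _
  let B : EuclideanSpace ℝ (Fin 4) →L[ℝ] EuclideanSpace ℝ (Fin 4) →L[ℝ] ℝ := g.form p
  have hB : B u v = ∑ i, ∑ j, (show EuclideanSpace ℝ (Fin 4) from mfderiv (𝓡 4) (𝓡 4) e p u) i
      * ((show EuclideanSpace ℝ (Fin 4) from mfderiv (𝓡 4) (𝓡 4) e p v) j
        * B (L (EuclideanSpace.single i 1)) (L (EuclideanSpace.single j 1))) := by
    conv_lhs => rw [hexp u, hexp v]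
    simp only [map_sum, map_smul, sum_apply, smul_apply,
      smul_eq_mul, Finset.mul_sum]
    rw [Finset.sum_comm]
    simp only [mul_left_comm]
  refine hB.trans (Finset.sum_congr rfl fun i _ => Finset.sum_congr rfl fun j _ => ?_)
  rw [hG]
  change _ = B _ _ * _ * _
  ring

theorem isMetricOn (he : e ∈ IsManifold.maximalAtlas (𝓡 4) ∞ M) :
    Coord.IsMetricOn (g.components e) e.target where
  isOpen := e.open_target
  smooth := g.contDiffOn_components he
  symm y _ i j := g.symm _ _ _
  det_ne y hy := by
    intro h0
    obtain ⟨v, hv0, hv⟩ := Matrix.exists_mulVec_eq_zero_iff.2 h0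
    have hd := mdifferentiable_of_mem_maximalAtlas he
    set p := e.symm y with hp
    have hps : p ∈ e.source := e.map_target hy
    have hep : e p = y := e.right_inv hy
    obtain ⟨w, hw⟩ := (hd.mfderiv_bijective hps).2 (WithLp.toLp 2 v)
    have hzero (u : TangentSpace (𝓡 4) p) : g.form p u w = 0 := by
      rw [g.form_eq_bil he hps, hw, hep, Coord.bil_eq_dotProduct]
      change _ ⬝ᵥ (g.components e y).mulVec v = 0
      rw [hv, dotProduct_zero]
    obtain ⟨b, hb⟩ := g.signature p
    have hw0 : w = 0 := by
      rw [← b.sum_repr w]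
      refine Finset.sum_eq_zero fun i _ => ?_
      have h1 := hzero (b i)
      rw [← b.sum_repr w, map_sum] at h1
      simp only [map_smul, smul_eq_mul, hb, Matrix.diagonal_apply] at h1
      have h2 : b.repr w i = 0 := by
        fin_cases i <;> simpa [Fin.sum_univ_four] using h1
      rw [h2, zero_smul]
    rw [hw0, map_zero] at hw
    exact hv0 (congrArg WithLp.ofLp hw).symm

end LorentzMetric

/-! ### Spatial hypersurfaces in charts -/

namespace SpatialHypersurface

open Coord

variable {M : Type*} [TopologicalSpace M] [ChartedSpace (EuclideanSpace ℝ (Fin 4)) M]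
  [IsManifold (𝓡 4) ∞ M] {g : LorentzMetric M}
  {S : Type*} [TopologicalSpace S] [ChartedSpace (EuclideanSpace ℝ (Fin 3)) S]
  [IsManifold (𝓡 3) ∞ S] (h : SpatialHypersurface g S)
  {e : OpenPartialHomeomorph M (EuclideanSpace ℝ (Fin 4))}
  {f : OpenPartialHomeomorph S (EuclideanSpace ℝ (Fin 3))} {x : EuclideanSpace ℝ (Fin 3)}

/-- The coordinate domain on which the immersion takes values in the domain of the chart `e`. -/
def coordDomain (e : OpenPartialHomeomorph M (EuclideanSpace ℝ (Fin 4)))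
    (f : OpenPartialHomeomorph S (EuclideanSpace ℝ (Fin 3))) : Set (EuclideanSpace ℝ (Fin 3)) :=
  f.target ∩ f.symm ⁻¹' (h.imm ⁻¹' e.source)

theorem isSmoothMapOn (he : e ∈ IsManifold.maximalAtlas (𝓡 4) ∞ M)
    (hf : f ∈ IsManifold.maximalAtlas (𝓡 3) ∞ S) :
    IsSmoothMapOn (h.immCoord e f) (h.coordDomain e f) e.target where
  isOpen := f.isOpen_inter_preimage_symm
    (e.open_source.preimage h.contMDiff_imm.continuous)
  smooth := by
    rw [← contMDiffOn_iff_contDiffOn]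
    refine (contMDiffOn_of_mem_maximalAtlas he).comp (t := e.source)
      (h.contMDiff_imm.comp_contMDiffOn ((contMDiffOn_symm_of_mem_maximalAtlas hf).mono
        Set.inter_subset_left)) fun z hz => hz.2
  mapsTo := fun z hz => e.map_source hz.2

/-- The components of a pushed forward coordinate vector. -/
theorem mfderiv_imm (he : e ∈ IsManifold.maximalAtlas (𝓡 4) ∞ M)
    (hf : f ∈ IsManifold.maximalAtlas (𝓡 3) ∞ S) (hx : x ∈ h.coordDomain e f) (i : Fin 3) :
    (show EuclideanSpace ℝ (Fin 4) from mfderiv (𝓡 4) (𝓡 4) e (h.imm (f.symm x))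
      (mfderiv (𝓡 3) (𝓡 4) h.imm (f.symm x)
        (mfderiv (𝓡 3) (𝓡 3) f.symm x (EuclideanSpace.single i (1 : ℝ))))).ofLp
      = tangent (h.immCoord e f) x i := by
  have hY := h.isSmoothMapOn he hf
  have h1 : MDifferentiableAt (𝓡 4) (𝓡 4) e (h.imm (f.symm x)) :=
    (mdifferentiable_of_mem_maximalAtlas he).mdifferentiableAt hx.2
  have h2 : MDifferentiableAt (𝓡 3) (𝓡 4) h.imm (f.symm x) :=
    h.contMDiff_imm.mdifferentiable (by simp) _
  have h3 : MDifferentiableAt (𝓡 3) (𝓡 3) f.symm x :=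
    (mdifferentiable_of_mem_maximalAtlas hf).mdifferentiableAt_symm hx.1
  have hcomp : fderiv ℝ (h.immCoord e f) x (EuclideanSpace.single i (1 : ℝ))
      = mfderiv (𝓡 4) (𝓡 4) e (h.imm (f.symm x)) (mfderiv (𝓡 3) (𝓡 4) h.imm (f.symm x)
        (mfderiv (𝓡 3) (𝓡 3) f.symm x (EuclideanSpace.single i (1 : ℝ)))) := by
    rw [← mfderiv_eq_fderiv]
    have h4 := mfderiv_comp_apply x (f := h.imm ∘ f.symm) (g := e) h1 (h2.comp x h3)
      (EuclideanSpace.single i (1 : ℝ))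
    have h5 := mfderiv_comp_apply x (f := f.symm) (g := h.imm) h2 h3
      (EuclideanSpace.single i (1 : ℝ))
    rw [h5] at h4
    exact h4
  funext μ
  rw [← hcomp, tangent, pd_apply i (differentiableAt_of_contDiffOn hY.isOpen hY.smooth hx)]

theorem gram_eq (he : e ∈ IsManifold.maximalAtlas (𝓡 4) ∞ M)
    (hf : f ∈ IsManifold.maximalAtlas (𝓡 3) ∞ S) (hx : x ∈ h.coordDomain e f) (i j : Fin 3) :
    bil (g.components e (h.immCoord e f x)) (tangent (h.immCoord e f) x i)
      (tangent (h.immCoord e f) x j) = h.gamma f x i j := by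
  rw [← h.mfderiv_imm he hf hx, ← h.mfderiv_imm he hf hx]
  exact (g.form_eq_bil he hx.2 _ _).symm

theorem bil_normal_tangent (he : e ∈ IsManifold.maximalAtlas (𝓡 4) ∞ M)
    (hf : f ∈ IsManifold.maximalAtlas (𝓡 3) ∞ S) (hx : x ∈ h.coordDomain e f) (i : Fin 3) :
    bil (g.components e (h.immCoord e f x)) (h.normalUp e f x)
      (tangent (h.immCoord e f) x i) = 0 := by
  rw [← h.mfderiv_imm he hf hx]
  exact (g.form_eq_bil he hx.2 _ _).symm.trans (h.normal_orthogonal _ _)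

theorem bil_normal_normal (he : e ∈ IsManifold.maximalAtlas (𝓡 4) ∞ M)
    (hx : x ∈ h.coordDomain e f) :
    bil (g.components e (h.immCoord e f x)) (h.normalUp e f x) (h.normalUp e f x) = -1 :=
  (g.form_eq_bil he hx.2 _ _).symm.trans (h.normal_unit _)

theorem contDiffOn_normalUp (he : e ∈ IsManifold.maximalAtlas (𝓡 4) ∞ M)
    (hf : f ∈ IsManifold.maximalAtlas (𝓡 3) ∞ S) (μ : Fin 4) :
    ContDiffOn ℝ ∞ (fun z => h.normalUp e f z μ) (h.coordDomain e f) := by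
  have h1 : ContMDiffOn (𝓡 3) (𝓡 4).tangent ∞ (fun z => (⟨h.imm (f.symm z), h.normal (f.symm z)⟩ :
      TangentBundle (𝓡 4) M)) (h.coordDomain e f) :=
    h.contMDiff_normal.comp_contMDiffOn ((contMDiffOn_symm_of_mem_maximalAtlas hf).mono
        Set.inter_subset_left)
  have h2 := (contMDiffOn_of_mem_maximalAtlas he).mfderiv_field e.open_source h1 fun z hz => hz.2
  have h3 := ((contMDiff_snd_tangentBundle_modelSpace (EuclideanSpace ℝ (Fin 4))
    (𝓡 4)).comp_contMDiffOn h2).contDiffOn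
  exact (EuclideanSpace.proj μ : EuclideanSpace ℝ (Fin 4) →L[ℝ] ℝ).contDiff.comp_contDiffOn h3

/-- The induced metric is positive definite, as the hypersurface is spatial. -/
theorem det_gamma_pos (hf : f ∈ IsManifold.maximalAtlas (𝓡 3) ∞ S) (hx : x ∈ f.target) :
    0 < (h.gamma f x).det := by
  refine Matrix.PosDef.det_pos (Matrix.PosDef.of_dotProduct_mulVec_pos ?_ fun v hv => ?_)
  · ext i j
    exact g.symm _ _ _
  · have hd := mdifferentiable_of_mem_maximalAtlas hf
    let D : EuclideanSpace ℝ (Fin 3) →L[ℝ] EuclideanSpace ℝ (Fin 3) :=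
      mfderiv (𝓡 3) (𝓡 3) f.symm x
    let I : EuclideanSpace ℝ (Fin 3) →L[ℝ] EuclideanSpace ℝ (Fin 4) :=
      mfderiv (𝓡 3) (𝓡 4) h.imm (f.symm x)
    let B : EuclideanSpace ℝ (Fin 4) →L[ℝ] EuclideanSpace ℝ (Fin 4) →L[ℝ] ℝ :=
      g.form (h.imm (f.symm x))
    have hD : D (WithLp.toLp 2 v) ≠ 0 := by
      intro h0
      have hinj := (hd.symm.mfderiv_bijective (x := x) hx).1
      have := hinj (h0.trans (map_zero D).symm)
      exact hv (congrArg WithLp.ofLp this)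
    have hpos : 0 < B (I (D (WithLp.toLp 2 v))) (I (D (WithLp.toLp 2 v))) :=
      h.spacelike (f.symm x) _ hD
    have hexp : (WithLp.toLp 2 v : EuclideanSpace ℝ (Fin 3))
        = ∑ i, v i • EuclideanSpace.single i (1 : ℝ) := by
      ext k
      simp [Finset.sum_apply, Pi.single_apply]
    rw [star_trivial, ← bil_eq_dotProduct]
    refine hpos.trans_eq ?_
    rw [hexp]
    simp only [map_sum, map_smul, sum_apply, smul_apply,
      smul_eq_mul, Finset.mul_sum]
    rw [Finset.sum_comm]
    refine Finset.sum_congr rfl fun i _ => Finset.sum_congr rfl fun j _ => ?_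
    change _ = B (I (D _)) (I (D _)) * _ * _
    ring

/-- The coordinate expressions of a spatial hypersurface satisfy `Coord.IsHypersurface`; in
particular `K_{ij} = -∇ᵢnⱼ` equals `g(∇ᵢ∂ⱼY, N)`. -/
theorem isHypersurface (he : e ∈ IsManifold.maximalAtlas (𝓡 4) ∞ M)
    (hf : f ∈ IsManifold.maximalAtlas (𝓡 3) ∞ S) :
    IsHypersurface (g.components e) e.target (h.immCoord e f) (h.coordDomain e f)
      (h.normalUp e f) (h.gamma f) (h.extrinsicCurvature e f) where
  metric := g.isMetricOn he
  map := h.isSmoothMapOn he hf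
  smooth_normal := h.contDiffOn_normalUp he hf
  induced :=
    { isOpen := (h.isSmoothMapOn he hf).isOpen
      smooth := fun i j => ((g.isMetricOn he).contDiffOn_bil (h.isSmoothMapOn he hf)
        ((h.isSmoothMapOn he hf).contDiffOn_tangent i)
        ((h.isSmoothMapOn he hf).contDiffOn_tangent j)).congr
          fun z hz => (h.gram_eq he hf hz i j).symm
      symm := fun y _ i j => g.symm _ _ _
      det_ne := fun y hy => (h.det_gamma_pos hf hy.1).ne' }
  gram := fun x hx i j => h.gram_eq he hf hx i j
  orth := fun x hx i => h.bil_normal_tangent he hf hx i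
  unit := fun x hx => h.bil_normal_normal he hx
  second := fun x hx i j => by
    have hG := g.isMetricOn he
    have hY := h.isSmoothMapOn he hf
    have hnd (ν : Fin 4) : ContDiffOn ℝ ∞ (fun z => h.normalDown e f z ν) (h.coordDomain e f) :=
      ContDiffOn.sum fun _ _ => (hY.contDiffOn_comp (hG.smooth _ _)).mul
        (h.contDiffOn_normalUp he hf _)
    have hbil (z : EuclideanSpace ℝ (Fin 3)) (hz : z ∈ h.coordDomain e f) (u : Fin 4 → ℝ) :
        bil (g.components e (h.immCoord e f z)) u (h.normalUp e f z)
          = ∑ ν, u ν * h.normalDown e f z ν := by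
      simp only [bil, normalDown, Finset.mul_sum]
      refine Finset.sum_congr rfl fun ν _ => Finset.sum_congr rfl fun κ _ => ?_
      ring
    -- differentiating the orthogonality relation moves the derivative from `n` to `∂ⱼ`
    have hleib : ∑ ν, (pd i (fun z => tangent (h.immCoord e f) z j ν) x * h.normalDown e f x ν
        + tangent (h.immCoord e f) x j ν * pd i (fun z => h.normalDown e f z ν) x) = 0 := by
      have h0 : pd i (fun z => ∑ ν, tangent (h.immCoord e f) z j ν * h.normalDown e f z ν) x
          = 0 := by
        rw [pd_congr hY.isOpen (v := fun _ => 0) (fun z hz => ?_) hx, pd_const]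
        rw [← hbil z hz, bil_comm (hG.symm _ (hY.mapsTo hz)), h.bil_normal_tangent he hf hz]
      rw [← h0, pd_sum]
      · refine Finset.sum_congr rfl fun ν _ => ?_
        rw [pd_mul]
        · exact differentiableAt_of_contDiffOn hY.isOpen (hY.contDiffOn_tangent _ _) hx
        · exact differentiableAt_of_contDiffOn hY.isOpen (hnd ν) hx
      · intro ν _
        exact differentiableAt_of_contDiffOn hY.isOpen ((hY.contDiffOn_tangent _ _).mul (hnd ν)) hx
    rw [Finset.sum_add_distrib] at hleib
    rw [hbil x hx]
    simp only [extrinsicCurvature, Matrix.of_apply, covAlong, conn, add_mul, mul_sub,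
      Finset.sum_add_distrib, Finset.sum_sub_distrib]
    have hΓ : ∑ ν, h.tangentComp e f x j ν * ∑ l, ∑ μ,
          christoffel (g.components e) (h.immCoord e f x) l μ ν * h.tangentComp e f x i μ
            * h.normalDown e f x l
        = ∑ l, (∑ ν, (∑ μ, christoffel (g.components e) (h.immCoord e f x) l μ ν
            * tangent (h.immCoord e f) x i μ) * tangent (h.immCoord e f) x j ν)
            * h.normalDown e f x l := by
      simp only [Finset.mul_sum, Finset.sum_mul]
      rw [Finset.sum_comm]
      refine Finset.sum_congr rfl fun l _ => Finset.sum_congr rfl fun ν _ =>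
        Finset.sum_congr rfl fun μ _ => ?_
      simp only [tangentComp, tangent]
      ring
    rw [hΓ]
    have ht : ∑ ν, h.tangentComp e f x j ν * pd i (fun z => h.normalDown e f z ν) x
      = ∑ ν, tangent (h.immCoord e f) x j ν * pd i (fun z => h.normalDown e f z ν) x := rfl
    rw [ht]
    linarith

end SpatialHypersurface

end

theorem mainTheorem2
    {M : Type*} [TopologicalSpace M] [ChartedSpace (EuclideanSpace ℝ (Fin 4)) M]
    [IsManifold (𝓡 4) ∞ M]
    (g : LorentzMetric M) (hvac : g.IsVacuum)
    {S : Type*} [TopologicalSpace S] [ChartedSpace (EuclideanSpace ℝ (Fin 3)) S]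
    [IsManifold (𝓡 3) ∞ S]
    (h : SpatialHypersurface g S)
    (e : OpenPartialHomeomorph M (EuclideanSpace ℝ (Fin 4)))
    (he : e ∈ IsManifold.maximalAtlas (𝓡 4) ∞ M)
    (f : OpenPartialHomeomorph S (EuclideanSpace ℝ (Fin 3)))
    (hf : f ∈ IsManifold.maximalAtlas (𝓡 3) ∞ S)
    (x : EuclideanSpace ℝ (Fin 3)) (hx : x ∈ f.target) (hxe : h.imm (f.symm x) ∈ e.source) :
    (∀ i j : Fin 3,
      h.electricPart e f x i j =
        - Coord.ricci (h.gamma f) x i j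
        - (∑ k, ∑ l, (h.gamma f x)⁻¹ k l * h.extrinsicCurvature e f x k l)
            * h.extrinsicCurvature e f x i j
        + ∑ k, ∑ l, h.extrinsicCurvature e f x i k * (h.gamma f x)⁻¹ k l
            * h.extrinsicCurvature e f x l j) ∧
    (h.Compatible e f x →
      ∀ i j : Fin 3,
        h.magneticPart e f x i j =
          ∑ k, ∑ l, (∑ m, h.gamma f x i m * Coord.epsUp (h.gamma f) x ![m, k, l])
            * Coord.covDeriv (h.gamma f) (h.extrinsicCurvature e f) x l k j) := by
  have hV : x ∈ h.coordDomain e f := ⟨hx, hxe⟩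
  have hS := h.isHypersurface he hf
  have hric : ∀ a b, Coord.ricci (g.components e) (h.immCoord e f x) a b = 0 :=
    (g.isMetricOn he).ricci_eq_zero (e.map_source hxe) (hvac e he _ (e.map_source hxe))
  exact ⟨fun i j => hS.electric_eq hV hric i j,
    fun hor i j => hS.magnetic_eq hV hric (h.det_gamma_pos hf hx) hor i j⟩
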